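/- Let $\Delta_1=[\alpha_1,\beta_1]$, $\Delta_2=[\alpha_2,\beta_2]$ with $\alpha_1<\beta_1<\alpha_2<\beta_2$. Let $\mu_1,\mu_2$ be finite positive Borel measures on $\Delta_1,\Delta_2$ such that * $\mu_1$ is absolutely continuous on $\Delta_1$ and its density extends to a holomorphic non-vanishing function in a neighbourhood of $\Delta_1$; * $\mu_2$ is an absolutely continuous Szegő measure on $\Delta_2$: $\int_{\Delta_2}\log\mu_2'(x)\,dx>-\infty$. For $\vec n=(n_1,n_2)\in\mathbb Z_{\ge 0}^2$, $|\vec n|=n_1+n_2$, let $P_{\vec n}$ be the monic polynomial of degree $|\vec n|$ with $\int P_{\vec n}(x)x^l\,d\mu_i(x)=0$ for $0\le l<n_i$, $i=1,2$. Let $x_{\vec n,1}<\dots<x_{\vec n,n_1}$ be the zeros of $P_{\vec n}$ on $\Delta_1$ and write $P_{\vec n}=P_{\vec n,1}P_{\vec n,2}$ with $P_{\vec n,1}(z)=\prod_i(z-x_{\vec n,i})$. Put $\vec e_1=(1,0)$, $\vec e_2=(0,1)$. Let $w_2(z)=\sqrt{(z-\alpha_2)(z-\beta_2)}$ be the branch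 holomorphic off $\Delta_2$ with $w_2(z)/z\to1$ as $z\to\infty$, let $w_{2+}$ be its trace on $\Delta_2$ from the upper half-plane, and set $$\varphi_2(z)=\tfrac12\Big(z-\tfrac{\alpha_2+\beta_2}2+w_2(z)\Big),\quad A_{0,2}=\Big(\tfrac{\beta_2-\alpha_2}4\Big)^2,\quad B_{0,2}=\tfrac{\alpha_2+\beta_2}2,\quad B_{0,1}=B_{0,2}+\varphi_2(\alpha_1),$$ $$\rho_2(x)=-2\pi i\,\mu_2'(x),\qquad S_{\rho_2}(z)=\exp\Big\{\frac{w_2(z)}{2\pi i}\int_{\Delta_2}\frac{\log(\rho_2w_{2+})(x)}{z-x}\frac{dx}{w_{2+}(x)}\Big\},$$ $$S(z;x_0)=\Big(\frac{\varphi_2(z)-\varphi_2(x_0)}{\varphi_2(x_0)\varphi_2(z)-A_{0,2}}\,\frac{\varphi_2(x_0)\varphi_2(z)}{z-x_0}\Big)^{1/2},\qquad S(\infty;x_0)=1,$$ the last being the branch holomorphic in $\overline{\mathbb C}\setminus\Delta_2$. For a set $\mathcal N$ of multi-indices consider the asymptotic formula $$(\ast)\qquad P_{\vec n,2}(z)=(1+o(1))\,\frac{S_{\rho_2}(z)}{S_{\rho_2}(\infty)}\Big(\prod_{i=1}^{n_1}S(z;x_{\vec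 n,i})\Big)\varphi_2(z)^{n_2}\qquad(|\vec n|\to\infty,\ \vec n\in\mathcal N),$$ uniformly on compact subsets of $\overline{\mathbb C}\setminus\Delta_2$ (validity of $(\ast)$ includes convergence of the integral that defines $S_{\rho_2}$). Let $\mathcal N_0$ be a marginal sequence of multi-indices, that is, $n_1/n_2\to0$ as $|\vec n|\to\infty$, $\vec n\in\mathcal N_0$, and assume that $(\ast)$ holds along $\mathcal N_0$. Then all zeros of $P_{\vec n}$ on $\Delta_1$ tend to $\alpha_1$: $\max_i|x_{\vec n,i}-\alpha_1|\to0$ as $|\vec n|\to\infty$, $\vec n\in\mathcal N_0$. Moreover, for each $i\in\{1,2\}$ such that $(\ast)$ also holds along the (again marginal) sequence $\{\vec n+\vec e_i:\vec n\in\mathcal N_0\}$, $$\lim_{|\vec n|\to\infty,\ \vec n\in\mathcal N_0}\ \lim_{z\to\infty}\Big(\frac{P_{\vec n+\vec e_i}(z)}{P_{\vec n}(z)}-z\Big)=-B_{0,i},$$ where the inner limit exists for every $\vec n\in\mathcal N_0$. Consequently $b_{\vec n,i}\to B_{0,i}$ along $\mathcal N_0$, where $a_{\vec n,j},b_{\vec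 n,j}$ are real coefficients of the nearest-neighbour recurrence relations $zP_{\vec n}(z)=P_{\vec n+\vec e_j}(z)+b_{\vec n,j}P_{\vec n}(z)+a_{\vec n,1}P_{\vec n-\vec e_1}(z)+a_{\vec n,2}P_{\vec n-\vec e_2}(z)$, $j=1,2$ (terms with $n_k=0$, i.e. $P_{\vec n-\vec e_k}$ undefined, are absent). -/

import Mathlib

open MeasureTheory Filter Topology Set

noncomputable section

namespace Angelesco

/-- `|n| → ∞` along the set of multi-indices `N`. -/
def along (N : Set (ℕ × ℕ)) : Filter (ℕ × ℕ) :=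
  comap (fun n : ℕ × ℕ => n.1 + n.2) atTop ⊓ 𝓟 N

/-- `N` is a marginal sequence of multi-indices: `n₁ / n₂ → 0` as `|n| → ∞`, `n ∈ N`
(in particular `n₂` is eventually positive). -/
def IsMarginal (N : Set (ℕ × ℕ)) : Prop :=
  (∀ᶠ n in along N, 0 < n.2) ∧ Tendsto (fun n : ℕ × ℕ => (n.1 : ℝ) / (n.2 : ℝ)) (along N) (𝓝 0)

/-- The standard unit multi-indices `e₁ = (1, 0)`, `e₂ = (0, 1)`. -/
def e : Fin 2 → ℕ × ℕ := ![(1, 0), (0, 1)]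

/-- `p` is the monic type II multiple orthogonal polynomial of multi-index `n`. -/
def IsTypeII (μ₁ μ₂ : Measure ℝ) (n : ℕ × ℕ) (p : Polynomial ℝ) : Prop :=
  p.Monic ∧ p.natDegree = n.1 + n.2 ∧
    (∀ l < n.1, ∫ x, p.eval x * x ^ l ∂μ₁ = 0) ∧
    (∀ l < n.2, ∫ x, p.eval x * x ^ l ∂μ₂ = 0)

/-- `μ` is absolutely continuous on `[a, b]`, and its density extends to a holomorphic
non-vanishing function in a neighbourhood of `[a, b]`. -/
def HasAnalyticDensity (μ : Measure ℝ) (a b : ℝ) : Prop :=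
  ∃ (U : Set ℂ) (f : ℂ → ℂ), IsOpen U ∧ (∀ x ∈ Icc a b, (x : ℂ) ∈ U) ∧
    DifferentiableOn ℂ f U ∧ (∀ z ∈ U, f z ≠ 0) ∧
    (∀ x ∈ Icc a b, (f x).im = 0 ∧ 0 < (f x).re) ∧
    μ = (volume.restrict (Icc a b)).withDensity (fun x : ℝ => ENNReal.ofReal (f x).re)

/-- The density `μ'` of `μ` with respect to Lebesgue measure. -/
def density (μ : Measure ℝ) (x : ℝ) : ℝ := (μ.rnDeriv volume x).toReal

/-- `μ` is an absolutely continuous measure on `[a, b]` with `∫ log μ'(x) dx > -∞`.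
(As `log` of a finite measure's density is bounded above by an integrable function, this
says that `μ' > 0` almost everywhere and that `log μ'` is integrable.) -/
def IsSzegoMeasure (μ : Measure ℝ) (a b : ℝ) : Prop :=
  μ ≪ volume ∧ μ (Icc a b)ᶜ = 0 ∧ (∀ᵐ x ∂volume.restrict (Icc a b), 0 < density μ x) ∧
    IntegrableOn (fun x => Real.log (density μ x)) (Icc a b)

/-- The branch of `√((z - a)(z - b))` that is holomorphic outside of `[a, b]` and
behaves like `z` at infinity; see `w_sq`, `differentiableAt_w`, `tendsto_w_div`. -/
def w (a b : ℝ) (z : ℂ) : ℂ :=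
  (z - ((a + b) / 2 : ℝ)) *
    (1 - (((b - a) / 2 : ℝ) / (z - ((a + b) / 2 : ℝ))) ^ 2) ^ (1 / 2 : ℂ)

theorem arg_mem_slitPlane {a b : ℝ} {z : ℂ} (hz : ∀ x ∈ Icc a b, (x : ℂ) ≠ z) (hab : a < b) :
    1 - ((((b - a) / 2 : ℝ) : ℂ) / (z - ((a + b) / 2 : ℝ))) ^ 2 ∈ Complex.slitPlane := by
  have hm : z - ((a + b) / 2 : ℝ) ≠ 0 := by
    intro h
    exact hz ((a + b) / 2) ⟨by linarith, by linarith⟩ (sub_eq_zero.mp h).symm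
  set r : ℝ := (b - a) / 2 with hr
  set u : ℂ := (r : ℂ) / (z - ((a + b) / 2 : ℝ)) with hu
  by_contra hn
  rw [Complex.mem_slitPlane_iff, not_or, not_lt, not_not] at hn
  obtain ⟨h1, h2⟩ := hn
  simp only [pow_two, Complex.sub_re, Complex.sub_im, Complex.mul_re, Complex.mul_im,
    Complex.one_re, Complex.one_im] at h1 h2
  have hr0 : 0 < r := by rw [hr]; linarith
  have him : u.im = 0 := by
    by_contra h
    have : u.re = 0 := by
      have : u.re * u.im = 0 := by linarith
      exact (mul_eq_zero.mp this).resolve_right h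
    rw [this] at h1
    nlinarith [mul_self_nonneg u.im]
  rw [him] at h1
  have hure : u = (u.re : ℂ) := Complex.ext rfl (by simpa using him)
  have hu0 : u.re ≠ 0 := by
    intro h; rw [h] at h1; norm_num at h1
  have hzz : z = ((((a + b) / 2) + r / u.re : ℝ) : ℂ) := by
    have h3 : u * (z - ((a + b) / 2 : ℝ)) = r := by
      rw [hu]; field_simp
    rw [hure] at h3
    have h4 : (u.re : ℂ) ≠ 0 := by exact_mod_cast hu0
    push_cast at h3 ⊢
    field_simp
    linear_combination 2 * h3
  have hle : |r / u.re| ≤ r := by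
    rw [abs_div, abs_of_pos hr0, div_le_iff₀ (abs_pos.mpr hu0)]
    have : 1 ≤ |u.re| := by
      rw [← sq_le_sq₀ zero_le_one (abs_nonneg _), sq_abs]; nlinarith
    nlinarith
  obtain ⟨h5, h6⟩ := abs_le.mp hle
  exact hz _ ⟨by rw [hr] at h5; linarith, by rw [hr] at h6; linarith⟩ hzz.symm

theorem w_sq {a b : ℝ} {z : ℂ} (hm : z ≠ ((a + b) / 2 : ℝ)) :
    w a b z ^ 2 = (z - a) * (z - b) := by
  have hm' : z - ((a + b) / 2 : ℝ) ≠ 0 := sub_ne_zero.mpr hm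
  rw [w, mul_pow, one_div, show (2 : ℂ)⁻¹ = ((2 : ℕ) : ℂ)⁻¹ by norm_num,
    Complex.cpow_nat_inv_pow _ two_ne_zero]
  field_simp
  push_cast
  ring

theorem differentiableAt_w {a b : ℝ} {z : ℂ} (hab : a < b) (hz : ∀ x ∈ Icc a b, (x : ℂ) ≠ z) :
    DifferentiableAt ℂ (w a b) z := by
  have hm : z - ((a + b) / 2 : ℝ) ≠ 0 := by
    intro h
    exact hz ((a + b) / 2) ⟨by linarith, by linarith⟩ (sub_eq_zero.mp h).symm
  unfold w
  have h1 : DifferentiableAt ℂ (fun z : ℂ => z - ((a + b) / 2 : ℝ)) z :=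
    differentiableAt_id.sub_const _
  have h2 : DifferentiableAt ℂ
      (fun z : ℂ => 1 - ((((b - a) / 2 : ℝ) : ℂ) / (z - ((a + b) / 2 : ℝ))) ^ 2) z :=
    (((differentiableAt_const _).div h1 hm).pow 2).const_sub 1
  exact h1.mul (h2.cpow_const (arg_mem_slitPlane hz hab))

theorem tendsto_w_div (a b : ℝ) :
    Tendsto (fun z => w a b z / z) (Bornology.cobounded ℂ) (𝓝 1) := by
  have h0 : Tendsto (fun z : ℂ => z⁻¹) (Bornology.cobounded ℂ) (𝓝 0) :=
    tendsto_inv₀_cobounded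
  have h1 : Tendsto (fun z : ℂ => (z - ((a + b) / 2 : ℝ))⁻¹) (Bornology.cobounded ℂ) (𝓝 0) :=
    tendsto_inv₀_cobounded.comp (tendsto_sub_const_cobounded _)
  have h2 : Tendsto (fun z : ℂ => (1 - ((((b - a) / 2 : ℝ) : ℂ) *
      (z - ((a + b) / 2 : ℝ))⁻¹) ^ 2) ^ (1 / 2 : ℂ)) (Bornology.cobounded ℂ) (𝓝 1) := by
    have h3 : Tendsto (fun z : ℂ => 1 - ((((b - a) / 2 : ℝ) : ℂ) *
        (z - ((a + b) / 2 : ℝ))⁻¹) ^ 2) (Bornology.cobounded ℂ) (𝓝 1) := by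
      simpa using tendsto_const_nhds.sub ((h1.const_mul (((b - a) / 2 : ℝ) : ℂ)).pow 2)
    simpa using h3.cpow (tendsto_const_nhds (x := (1 / 2 : ℂ))) (by simp)
  have h4 : Tendsto (fun z : ℂ => 1 - (((a + b) / 2 : ℝ) : ℂ) * z⁻¹)
      (Bornology.cobounded ℂ) (𝓝 1) := by
    simpa using tendsto_const_nhds.sub (h0.const_mul (((a + b) / 2 : ℝ) : ℂ))
  have h5 := h4.mul h2
  rw [one_mul] at h5
  refine h5.congr' ?_
  filter_upwards [Bornology.eventually_ne_cobounded (0 : ℂ)] with z hz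
  simp only [w]
  rw [← div_eq_mul_inv (((b - a) / 2 : ℝ) : ℂ), show (1 - (((a + b) / 2 : ℝ) : ℂ) * z⁻¹) = (z - ((a + b) / 2 : ℝ)) * z⁻¹ by
    rw [sub_mul, mul_inv_cancel₀ hz]]
  ring

/-- The trace of `w a b` on `[a, b]` from the upper half-plane. -/
def wPlus (a b x : ℝ) : ℂ := Complex.I * (Real.sqrt ((x - a) * (b - x)) : ℝ)

/-- The conformal map `φ` of the complement of `[a, b]` onto the complement of the disk of
radius `(b - a) / 4` with `φ(z) = z + O(1)`. -/
def phi (a b : ℝ) (z : ℂ) : ℂ := (z - ((a + b) / 2 : ℝ) + w a b z) / 2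

/-- `ρ(x) = -2πi μ'(x)`. -/
def rho (μ : Measure ℝ) (x : ℝ) : ℂ := -2 * Real.pi * Complex.I * (density μ x : ℂ)

/-- The Szegő function `S_ρ` of `μ` outside of `[a, b]`. On `(a, b)` the quantity `ρ w₊` is
non-negative. -/
def szego (μ : Measure ℝ) (a b : ℝ) (z : ℂ) : ℂ :=
  Complex.exp (w a b z / (2 * Real.pi * Complex.I) *
    ∫ x in Icc a b, Complex.log (rho μ x * wPlus a b x) / (z - x) / wPlus a b x)

/-- The value `S_ρ(∞)`, since `w(z) / (z - x) → 1` as `z → ∞`. -/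
def szegoInf (μ : Measure ℝ) (a b : ℝ) : ℂ :=
  Complex.exp (1 / (2 * Real.pi * Complex.I) *
    ∫ x in Icc a b, Complex.log (rho μ x * wPlus a b x) / wPlus a b x)

/-- The integral defining the Szegő function converges. -/
def SzegoDefined (μ : Measure ℝ) (a b : ℝ) : Prop :=
  IntegrableOn (fun x => Complex.log (rho μ x * wPlus a b x) / wPlus a b x) (Icc a b)

/-- `A = ((b - a) / 4)²`. -/
def constA (a b : ℝ) : ℝ := ((b - a) / 4) ^ 2

/-- The function
`S(z; x₀) = ( (φ(z) - φ(x₀)) / (φ(x₀) φ(z) - A) · φ(x₀) φ(z) / (z - x₀) ) ^ (1/2)`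
with `S(∞; x₀) = 1`. The quotient `(φ(z) - φ(x₀)) / (z - x₀)` is written as `dslope φ x₀ z`,
so that it is `φ'(x₀)` at the removable singularity `z = x₀`. The principal root is the
holomorphic branch with value `1` at infinity; see `S_eq`. -/
def S (a b : ℝ) (z : ℂ) (x₀ : ℝ) : ℂ :=
  (dslope (phi a b) (x₀ : ℂ) z * (phi a b x₀ * phi a b z) /
    (phi a b x₀ * phi a b z - constA a b)) ^ (1 / 2 : ℂ)

theorem phi_quadratic {a b : ℝ} {z : ℂ} (hm : z ≠ ((a + b) / 2 : ℝ)) :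
    phi a b z ^ 2 - (z - ((a + b) / 2 : ℝ)) * phi a b z + constA a b = 0 := by
  have h := w_sq hm
  simp only [phi, constA]
  push_cast at h ⊢
  linear_combination (1 / 4) * h

theorem norm_phi_gt {a b : ℝ} {z : ℂ} (hab : a < b) (hz : ∀ x ∈ Icc a b, (x : ℂ) ≠ z) :
    (b - a) / 4 < ‖phi a b z‖ := by
  have hm : z ≠ ((a + b) / 2 : ℝ) := fun h =>
    hz ((a + b) / 2) ⟨by linarith, by linarith⟩ h.symm
  have hm' : z - ((a + b) / 2 : ℝ) ≠ 0 := sub_ne_zero.mpr hm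
  set s : ℂ := (1 - ((((b - a) / 2 : ℝ) : ℂ) / (z - ((a + b) / 2 : ℝ))) ^ 2) ^ (1 / 2 : ℂ) with hs
  have hre : 0 < s.re := by
    have harg := arg_mem_slitPlane hz hab
    have hne := Complex.slitPlane_ne_zero harg
    have hpi := (Complex.mem_slitPlane_iff_arg.mp harg).1
    rw [hs, Complex.cpow_def_of_ne_zero hne, Complex.exp_re]
    refine mul_pos (Real.exp_pos _) (Real.cos_pos_of_mem_Ioo ?_)
    have h1 := Complex.neg_pi_lt_arg
      (1 - ((((b - a) / 2 : ℝ) : ℂ) / (z - ((a + b) / 2 : ℝ))) ^ 2)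
    have h2 := lt_of_le_of_ne (Complex.arg_le_pi _) hpi
    have h3 : (Complex.log (1 - ((((b - a) / 2 : ℝ) : ℂ) / (z - ((a + b) / 2 : ℝ))) ^ 2) *
        (1 / 2 : ℂ)).im =
        Complex.arg (1 - ((((b - a) / 2 : ℝ) : ℂ) / (z - ((a + b) / 2 : ℝ))) ^ 2) / 2 := by
      rw [show (1 / 2 : ℂ) = ((1 / 2 : ℝ) : ℂ) by push_cast; rfl, Complex.im_mul_ofReal,
        Complex.log_im]
      ring
    rw [h3]
    constructor <;> linarith
  have hw : w a b z = (z - ((a + b) / 2 : ℝ)) * s := rfl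
  have hphi : phi a b z = (z - ((a + b) / 2 : ℝ)) * (1 + s) / 2 := by
    rw [phi, hw]; ring
  have hprod : phi a b z * ((z - ((a + b) / 2 : ℝ)) * (1 - s) / 2) = constA a b := by
    have h := phi_quadratic hm
    rw [hphi] at h ⊢
    linear_combination -h
  have hlt : ‖1 - s‖ < ‖1 + s‖ := by
    rw [← sq_lt_sq₀ (norm_nonneg _) (norm_nonneg _), ← Complex.normSq_eq_norm_sq,
      ← Complex.normSq_eq_norm_sq, Complex.normSq_apply, Complex.normSq_apply]
    simp only [Complex.sub_re, Complex.add_re, Complex.one_re, Complex.sub_im, Complex.add_im,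
      Complex.one_im]
    nlinarith
  have hlt2 : ‖(z - ((a + b) / 2 : ℝ)) * (1 - s) / 2‖ < ‖phi a b z‖ := by
    rw [hphi, norm_div, norm_div, norm_mul, norm_mul]
    have := norm_pos_iff.mpr hm'
    have h2 : (0 : ℝ) < ‖(2 : ℂ)‖ := by simp
    gcongr
  have hn := congrArg norm hprod
  rw [norm_mul, Complex.norm_real, constA, Real.norm_of_nonneg (by positivity)] at hn
  have hpos : 0 < ‖phi a b z‖ := (norm_nonneg _).trans_lt hlt2
  by_contra hcon
  rw [not_lt] at hcon
  nlinarith [mul_lt_mul_of_pos_left hlt2 hpos]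

theorem hasDerivAt_phi {a b : ℝ} {z : ℂ} (hab : a < b) (hz : ∀ x ∈ Icc a b, (x : ℂ) ≠ z) :
    HasDerivAt (phi a b) (phi a b z / w a b z) z := by
  have hm : z ≠ ((a + b) / 2 : ℝ) := fun h =>
    hz ((a + b) / 2) ⟨by linarith, by linarith⟩ h.symm
  have hsq := w_sq hm
  have hw0 : w a b z ≠ 0 := by
    intro h
    rw [h, zero_pow two_ne_zero] at hsq
    rcases mul_eq_zero.mp hsq.symm with h | h
    · exact hz a ⟨le_rfl, hab.le⟩ (sub_eq_zero.mp h).symm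
    · exact hz b ⟨hab.le, le_rfl⟩ (sub_eq_zero.mp h).symm
  have hd := (differentiableAt_w hab hz).hasDerivAt
  have h1 := hd.pow 2
  have h2 : HasDerivAt (fun y : ℂ => (y - a) * (y - b)) ((z - b) + (z - a)) z := by
    refine (((hasDerivAt_id z).sub_const (a : ℂ)).mul
      ((hasDerivAt_id z).sub_const (b : ℂ))).congr_deriv ?_
    simp
  have h3 : (fun y : ℂ => (y - a) * (y - b)) =ᶠ[𝓝 z] (w a b ^ 2) := by
    filter_upwards [isOpen_ne.mem_nhds hm] with y hy
    exact (w_sq hy).symm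
  have h4 := h1.unique (h2.congr_of_eventuallyEq h3.symm)
  have hd' : deriv (w a b) z = (z - ((a + b) / 2 : ℝ)) / w a b z := by
    rw [eq_div_iff hw0]
    push_cast at h4 ⊢
    linear_combination (1 / 2) * h4
  have h5 := (((hasDerivAt_id z).sub_const (((a + b) / 2 : ℝ) : ℂ)).add hd).div_const 2
  refine h5.congr_deriv ?_
  rw [hd', phi]
  field_simp
  ring

/-- Outside of `[a, b]` the function `S` is `φ(x₀) φ(z) / (φ(x₀) φ(z) - A)`; in particular the
principal root in its definition is the holomorphic branch with value `1` at infinity. -/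
theorem S_eq {a b x₀ : ℝ} {z : ℂ} (hab : a < b) (hz : ∀ x ∈ Icc a b, (x : ℂ) ≠ z)
    (hx₀ : x₀ ∉ Icc a b) :
    S a b z x₀ = phi a b x₀ * phi a b z / (phi a b x₀ * phi a b z - constA a b) := by
  have hx : ∀ x ∈ Icc a b, (x : ℂ) ≠ x₀ := by
    intro x hx h
    exact hx₀ (Complex.ofReal_injective h ▸ hx)
  have hm : z ≠ ((a + b) / 2 : ℝ) := fun h =>
    hz ((a + b) / 2) ⟨by linarith, by linarith⟩ h.symm
  have hmx : (x₀ : ℂ) ≠ ((a + b) / 2 : ℝ) := fun h =>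
    hx ((a + b) / 2) ⟨by linarith, by linarith⟩ h.symm
  have n1 := norm_phi_gt hab hz
  have n2 := norm_phi_gt hab hx
  have q1 := phi_quadratic hm
  have q2 := phi_quadratic hmx
  have d := (hasDerivAt_phi hab hx).deriv
  have wx : w a b x₀ = 2 * phi a b x₀ - (x₀ - ((a + b) / 2 : ℝ)) := by rw [phi]; ring
  have hr : 0 < (b - a) / 4 := by linarith
  have hp0 : phi a b z ≠ 0 := norm_pos_iff.mp (hr.trans n1)
  have hpx0 : phi a b x₀ ≠ 0 := norm_pos_iff.mp (hr.trans n2)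
  have hA : ‖(constA a b : ℂ)‖ < ‖phi a b x₀ * phi a b z‖ := by
    rw [Complex.norm_real, constA, Real.norm_of_nonneg (by positivity), norm_mul]
    nlinarith
  have hden : phi a b x₀ * phi a b z - constA a b ≠ 0 := by
    intro h
    rw [sub_eq_zero.mp h] at hA
    exact lt_irrefl _ hA
  unfold S
  set p := phi a b z
  set p₀ := phi a b x₀
  set A : ℂ := (constA a b : ℂ)
  have hrad : dslope (phi a b) (x₀ : ℂ) z * (p₀ * p) / (p₀ * p - A) =
      (p₀ * p / (p₀ * p - A)) ^ 2 := by
    have hslope : dslope (phi a b) (x₀ : ℂ) z = p₀ * p / (p₀ * p - A) := by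
      by_cases hzx : z = x₀
      · subst hzx
        rw [dslope_same, d]
        have hw : p₀ * w a b x₀ = p₀ * p₀ - A := by
          rw [wx]; linear_combination q2
        have hpp : p = p₀ := rfl
        rw [hpp] at hden ⊢
        rw [← hw] at hden ⊢
        have hw0 : w a b x₀ ≠ 0 := right_ne_zero_of_mul hden
        field_simp
      · rw [dslope_of_ne _ hzx, slope_def_field, div_eq_div_iff (sub_ne_zero.mpr hzx) hden]
        linear_combination p₀ * q1 - p * q2
    rw [hslope]; ring
  rw [hrad, one_div, show (2 : ℂ)⁻¹ = ((2 : ℕ) : ℂ)⁻¹ by norm_num]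
  have hre : 0 < (p₀ * p / (p₀ * p - A)).re := by
    rw [Complex.div_re]
    have hn := Complex.normSq_pos.mpr hden
    rw [← add_div]
    refine div_pos ?_ hn
    have key : (p₀ * p).re * (p₀ * p - A).re + (p₀ * p).im * (p₀ * p - A).im =
        ‖p₀ * p‖ ^ 2 - constA a b * (p₀ * p).re := by
      rw [← Complex.normSq_eq_norm_sq, Complex.normSq_apply]
      simp only [A, Complex.sub_re, Complex.sub_im, Complex.ofReal_re, Complex.ofReal_im]
      ring
    rw [key]
    have hA0 : 0 ≤ constA a b := by unfold constA; positivity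
    rw [Complex.norm_real, Real.norm_of_nonneg hA0] at hA
    nlinarith [Complex.re_le_norm (p₀ * p), mul_le_mul_of_nonneg_left
      (Complex.re_le_norm (p₀ * p)) hA0]
  refine Complex.pow_cpow_nat_inv two_ne_zero ?_ ?_ <;>
  · have := Complex.abs_arg_lt_pi_div_two_iff.mpr (Or.inl hre)
    rw [abs_lt] at this
    push_cast
    linarith

/-- The zeros of `p` on `[a, b]`, with multiplicity. -/
def zerosOn (p : Polynomial ℝ) (a b : ℝ) : Multiset ℝ := by
  classical exact p.roots.filter (fun x => x ∈ Icc a b)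

/-- The monic polynomial `p₁` whose zeros are the zeros of `p` on `[a, b]`. -/
def factorOn (p : Polynomial ℝ) (a b : ℝ) : Polynomial ℝ :=
  ((zerosOn p a b).map (fun x => Polynomial.X - Polynomial.C x)).prod

/-- The complementary factor `p₂ = p / p₁`. -/
def cofactorOn (p : Polynomial ℝ) (a b : ℝ) : Polynomial ℝ := p /ₘ factorOn p a b

/-- The asymptotic formula
`P_{n,2}(z) = (1 + o(1)) (S_ρ₂(z) / S_ρ₂(∞)) (∏ᵢ S(z; x_{n,i})) φ₂(z)^n₂`
as `|n| → ∞`, `n ∈ N`, uniformly on compact subsets of the Riemann sphere minus `[α₂, β₂]`,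
where `x_{n,i}` are the zeros of `P_n` on `[α₁, β₁]` and `P_{n,2}(z) = P_n(z) / ∏ᵢ (z - x_{n,i})`. -/
def VaryingAsymptotics (α₁ β₁ α₂ β₂ : ℝ) (μ₂ : Measure ℝ) (P : ℕ × ℕ → Polynomial ℝ)
    (N : Set (ℕ × ℕ)) : Prop :=
  SzegoDefined μ₂ α₂ β₂ ∧
  ∀ K : Set (OnePoint ℂ), IsCompact K → (∀ x ∈ Icc α₂ β₂, ((x : ℂ) : OnePoint ℂ) ∉ K) →
    ∀ ε > 0, ∀ᶠ n in along N, ∀ z : ℂ, (z : OnePoint ℂ) ∈ K →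
      ∃ o : ℂ, ‖o‖ ≤ ε ∧
        Polynomial.aeval z (cofactorOn (P n) α₁ β₁) =
          (1 + o) * (szego μ₂ α₂ β₂ z / szegoInf μ₂ α₂ β₂) *
            ((zerosOn (P n) α₁ β₁).map (fun x => S α₂ β₂ z x)).prod * phi α₂ β₂ z ^ n.2

/-- The limiting constants `B_{0,1} = B_{0,2} + φ₂(α₁)` and `B_{0,2} = (α₂ + β₂) / 2`. -/
def B₀ (α₁ α₂ β₂ : ℝ) : Fin 2 → ℂ :=
  ![((α₂ + β₂) / 2 : ℝ) + phi α₂ β₂ α₁, ((α₂ + β₂) / 2 : ℝ)]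

/-- `a i n`, `b i n` are the coefficients of the nearest-neighbour recurrence relations
`z P_n = P_{n+e_j} + b_{n,j} P_n + a_{n,1} P_{n-e₁} + a_{n,2} P_{n-e₂}`, where a term
`a_{n,i} P_{n-e_i}` with `n_i = 0` is absent. -/
def IsRecurrence (P : ℕ × ℕ → Polynomial ℝ) (a b : Fin 2 → ℕ × ℕ → ℝ) : Prop :=
  ∀ (n : ℕ × ℕ) (j : Fin 2),
    Polynomial.X * P n = P (n + e j) + Polynomial.C (b j n) * P n
      + (if n.1 = 0 then 0 else Polynomial.C (a 0 n) * P (n.1 - 1, n.2))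
      + (if n.2 = 0 then 0 else Polynomial.C (a 1 n) * P (n.1, n.2 - 1))

end Angelesco

end

/-! Orthogonality on the two disjoint intervals forces `n₁` simple zeros of `P_n` on the first
interval and `n₂` zeros on the second, and the degree leaves room for no others.

Zeros near `α₁`. Suppose that `P_n` has a zero `y ≥ α₁ + ε` on the first interval. Testing `P_n`
against `q`, the product over the other zeros there, gives `∫ (y - x) q² V dμ₁ = 0`, where `V(x) = ∏
(t - x)` runs over the zeros `t` on the second interval. `V` decreases exponentially fast in `n₂`
from `α₁ + ε/2` to `α₁ + ε`, so the positive part near `α₁` can be balanced by the negative part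
right of `y` only if `κ ^ n₂ ≤ C₀ C₁ ^ n₁` with some `κ > 1` (`IsSystem.exists_pow_le_of_root`). A
marginal sequence violates this eventually.

Ratio limits. The inner limit is the sum of the zeros of `P_n` minus that of `P_{n+e_i}`. The
quotient of `P_{n,2}` by `∏ S(·; x) φ₂ ^ n₂` is uniformly close to a Szegő factor that is
independent of `n`. Dividing its values at `n + e_i` and `n` removes this factor, and the Schwarz
lemma at infinity (`HasInvCoeff.norm_le`) makes the difference of the `1/z`-coefficients tend to
`0`. Since `x - A/φ(x) = φ(x) + B_{0,2}`, that difference equals the inner limit plus `B_{0,2}` plus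
the change in `∑ φ₂(x)` over the zeros on the first interval.

This change must be controlled although `n₁` may be unbounded. Consecutive polynomials have
interlacing zeros (`IsSystem.wronskian_ne_zero`, `exists_root_between`) and `φ₂` is monotone there,
so sums of `φ₂(x) - φ₂(α₁)` differ by at most the largest single term
(`sum_le_sum_add_of_interlacing`), which tends to `0`. What remains is `φ₂(α₁)` for each zero gained
on the first interval: one for `e₁`, none for `e₂`. -/

noncomputable section

namespace Angelesco

/-! ### Orthogonality forces zeros of odd multiplicity -/

section OddRoots

open Polynomial

theorem integrable_of_continuous_of_Icc {μ : Measure ℝ} [IsFiniteMeasure μ] {a b : ℝ}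
    (hμ : μ (Icc a b)ᶜ = 0) {f : ℝ → ℝ} (hf : Continuous f) : Integrable f μ := by
  have h : μ.restrict (Icc a b) = μ :=
    Measure.restrict_eq_self_of_ae_mem (mem_ae_iff.mpr hμ)
  rw [← h]
  exact hf.continuousOn.integrableOn_Icc

/-- Orthogonality to the monomials `x ^ l`, `l < n`, gives orthogonality to all polynomials
of degree less than `n`. -/
theorem integral_mul_eq_zero_of_orthogonal {μ : Measure ℝ} [IsFiniteMeasure μ] {a b : ℝ}
    (hμ : μ (Icc a b)ᶜ = 0) {Q r : ℝ[X]} {n : ℕ}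
    (hQ : ∀ l < n, ∫ x, Q.eval x * x ^ l ∂μ = 0) (hr : r.natDegree < n) :
    ∫ x, Q.eval x * r.eval x ∂μ = 0 := by
  simp_rw [eval_eq_sum_range' hr, Finset.mul_sum]
  rw [integral_finsetSum]
  · refine Finset.sum_eq_zero fun l hl => ?_
    have h : ∀ x : ℝ, Q.eval x * (r.coeff l * x ^ l) = r.coeff l * (Q.eval x * x ^ l) :=
      fun x => by ring
    simp_rw [h]
    rw [integral_const_mul, hQ l (Finset.mem_range.mp hl), mul_zero]
  · exact fun l _ => integrable_of_continuous_of_Icc hμ (by fun_prop)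

open scoped Classical in
/-- The zeros of odd multiplicity of `Q` on `[a, b]`. -/
def oddRoots (Q : ℝ[X]) (a b : ℝ) : Finset ℝ :=
  {c ∈ Q.roots.toFinset | c ∈ Icc a b ∧ Odd (Q.roots.count c)}

theorem exists_constant_sign {V : ℝ[X]} {a b : ℝ} (hV : ∀ x ∈ Icc a b, V.eval x ≠ 0) :
    (∀ x ∈ Icc a b, 0 ≤ V.eval x) ∨ ∀ x ∈ Icc a b, V.eval x ≤ 0 := by
  by_contra! h
  obtain ⟨⟨x, hx, hx0⟩, y, hy, hy0⟩ := h
  obtain ⟨z, hz, hz0⟩ := isPreconnected_Icc.intermediate_value hx hy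
    V.continuous.continuousOn ⟨hx0.le, hy0.le⟩
  exact hV z hz hz0

/-- One extra factor at each odd zero makes every multiplicity on `[a, b]` even; the cofactor `V`
has no zero there and keeps its sign. -/
theorem exists_constant_sign_mul_prod_oddRoots {Q : ℝ[X]} (hQ : Q ≠ 0) (a b : ℝ) :
    (∀ x ∈ Icc a b, 0 ≤ (Q * ∏ c ∈ oddRoots Q a b, (X - C c)).eval x) ∨
      ∀ x ∈ Icc a b, (Q * ∏ c ∈ oddRoots Q a b, (X - C c)).eval x ≤ 0 := by
  classical
  set M := Q.roots.filter (fun c => c ∈ Icc a b) with hM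
  obtain ⟨V, hV⟩ := (Multiset.prod_X_sub_C_dvd_iff_le_roots hQ M).mpr
    (Multiset.filter_le _ _)
  have hV0 : V ≠ 0 := by rintro rfl; simp at hV; exact hQ hV
  have hVr : ∀ x ∈ Icc a b, V.eval x ≠ 0 := by
    intro x hx h0
    have h1 : Q.roots = M + V.roots := by
      conv_lhs => rw [hV]
      rw [roots_mul (hV ▸ hQ), roots_multiset_prod_X_sub_C]
    have h2 := congrArg (Multiset.count x) h1
    rw [Multiset.count_add, hM, Multiset.count_filter_of_pos hx] at h2
    have h3 : x ∈ V.roots := (mem_roots hV0).mpr h0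
    have := Multiset.count_pos.mpr h3
    omega
  have hodd : oddRoots Q a b = {c ∈ M.toFinset | Odd (M.count c)} := by
    ext c
    simp only [oddRoots, hM, Finset.mem_filter, Multiset.mem_toFinset, Multiset.mem_filter]
    constructor
    · rintro ⟨h1, h2, h3⟩
      exact ⟨⟨h1, h2⟩, by rwa [Multiset.count_filter_of_pos h2]⟩
    · rintro ⟨⟨h1, h2⟩, h3⟩
      rw [Multiset.count_filter_of_pos h2] at h3
      exact ⟨h1, h2, h3⟩
  have key : ∀ x, 0 ≤ ((M.map fun c => X - C c).prod *
      ∏ c ∈ oddRoots Q a b, (X - C c)).eval x := by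
    intro x
    rw [hodd, Finset.prod_multiset_map_count, Finset.prod_filter, ← Finset.prod_mul_distrib,
      eval_prod]
    refine Finset.prod_nonneg fun c _ => ?_
    split_ifs with h
    · rw [← pow_succ, eval_pow]
      exact h.add_one.pow_nonneg _
    · rw [mul_one, eval_pow]
      exact (Nat.not_odd_iff_even.mp h).pow_nonneg _
  have heval : ∀ x, (Q * ∏ c ∈ oddRoots Q a b, (X - C c)).eval x =
      ((M.map fun c => X - C c).prod * ∏ c ∈ oddRoots Q a b, (X - C c)).eval x * V.eval x := by
    intro x
    rw [← eval_mul]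
    congr 1
    rw [mul_right_comm, ← hV]
  refine (exists_constant_sign hVr).imp (fun h x hx => ?_) (fun h x hx => ?_)
  · rw [heval]; exact mul_nonneg (key x) (h x hx)
  · rw [heval]; exact mul_nonpos_of_nonneg_of_nonpos (key x) (h x hx)

theorem eq_zero_of_ae_eval_eq_zero {μ : Measure ℝ} (hac : μ ≪ volume) (hμ0 : μ ≠ 0) {F : ℝ[X]}
    (hF : ∀ᵐ x ∂μ, F.eval x = 0) : F = 0 := by
  by_contra hF0
  refine hμ0 (Measure.measure_univ_eq_zero.mp ?_)
  have h1 : μ {x | F.eval x = 0} = 0 :=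
    hac ((finite_setOfPred_isRoot hF0).measure_zero volume)
  have h2 : μ {x | F.eval x = 0}ᶜ = 0 := mem_ae_iff.mp hF
  rw [← union_compl_self {x | F.eval x = 0}]
  exact measure_union_null h1 h2

/-- With fewer than `n` odd zeros, their product `r` would be an admissible test polynomial. Then `Q
r` has constant sign and zero integral, so it vanishes almost everywhere, hence identically. -/
theorem le_card_oddRoots {μ : Measure ℝ} [IsFiniteMeasure μ] {a b : ℝ}
    (hac : μ ≪ volume) (hμ0 : μ ≠ 0) (hμ : μ (Icc a b)ᶜ = 0) {Q : ℝ[X]} (hQ0 : Q ≠ 0) {n : ℕ}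
    (hQ : ∀ l < n, ∫ x, Q.eval x * x ^ l ∂μ = 0) : n ≤ (oddRoots Q a b).card := by
  by_contra! hlt
  set r : ℝ[X] := ∏ c ∈ oddRoots Q a b, (X - C c) with hr
  have hrm : r.Monic := monic_prod_X_sub_C _ _
  have hrd : r.natDegree < n := by rwa [hr, natDegree_prod_of_monic _ _
    (fun c _ => monic_X_sub_C c), Finset.sum_congr rfl (fun c _ => natDegree_X_sub_C c),
    Finset.sum_const, smul_eq_mul, mul_one]
  have hint := integral_mul_eq_zero_of_orthogonal hμ hQ hrd
  simp_rw [← eval_mul] at hint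
  have hI : Integrable (fun x => (Q * r).eval x) μ :=
    integrable_of_continuous_of_Icc hμ (Q * r).continuous
  have hmem : ∀ᵐ x ∂μ, x ∈ Icc a b := mem_ae_iff.mpr hμ
  refine mul_ne_zero hQ0 hrm.ne_zero (eq_zero_of_ae_eval_eq_zero hac hμ0 (F := Q * r) ?_)
  rcases exists_constant_sign_mul_prod_oddRoots hQ0 a b with h | h
  · exact (integral_eq_zero_iff_of_nonneg_ae (hmem.mono h) hI).mp hint
  · have h' := (integral_eq_zero_iff_of_nonneg_ae (f := fun x => -(Q * r).eval x)
      (hmem.mono fun x hx => neg_nonneg.mpr (h x hx)) hI.neg).mp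
      (by rw [integral_neg, hint, neg_zero])
    exact h'.mono fun x hx => neg_eq_zero.mp hx

theorem oddRoots_val_le (Q : ℝ[X]) (a b : ℝ) :
    (oddRoots Q a b).val ≤ Q.roots.filter (fun c => c ∈ Icc a b) := by
  classical
  rw [Multiset.le_iff_subset (oddRoots Q a b).nodup]
  intro c hc
  simp only [oddRoots, Finset.mem_val, Finset.mem_filter, Multiset.mem_toFinset] at hc
  exact Multiset.mem_filter.mpr ⟨hc.1, hc.2.1⟩

end OddRoots

/-- The two measures of an Angelesco system: finite, non-zero, absolutely continuous measures on
disjoint intervals. -/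
structure IsSystem (α₁ β₁ α₂ β₂ : ℝ) (μ₁ μ₂ : Measure ℝ) : Prop where
  lt₁ : α₁ < β₁
  lt₁₂ : β₁ < α₂
  lt₂ : α₂ < β₂
  finite₁ : IsFiniteMeasure μ₁
  finite₂ : IsFiniteMeasure μ₂
  ac₁ : μ₁ ≪ volume
  ac₂ : μ₂ ≪ volume
  ne_zero₁ : μ₁ ≠ 0
  ne_zero₂ : μ₂ ≠ 0
  supp₁ : μ₁ (Icc α₁ β₁)ᶜ = 0
  supp₂ : μ₂ (Icc α₂ β₂)ᶜ = 0

/-! ### Location and simplicity of zeros -/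

section Zeros

open Polynomial

variable {α₁ β₁ α₂ β₂ : ℝ} {μ₁ μ₂ : Measure ℝ}

theorem IsSystem.le_card_filter_add (h : IsSystem α₁ β₁ α₂ β₂ μ₁ μ₂) (M : Multiset ℝ) :
    M.filter (fun c => c ∈ Icc α₁ β₁) + M.filter (fun c => c ∈ Icc α₂ β₂) ≤ M := by
  classical
  rw [Multiset.le_iff_count]
  intro c
  rw [Multiset.count_add]
  have h1 := h.lt₁₂
  by_cases h2 : c ∈ Icc α₁ β₁
  · have h3 : c ∉ Icc α₂ β₂ := fun h3 => by linarith [h2.2, h3.1]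
    rw [Multiset.count_filter_of_pos h2, Multiset.count_filter_of_neg h3, add_zero]
  · rw [Multiset.count_filter_of_neg h2, zero_add]
    exact Multiset.count_le_of_le _ (Multiset.filter_le _ _)

/-- The zeros of a multiple orthogonal polynomial: `n₁` simple ones on `[α₁, β₁]` and `n₂` on
`[α₂, β₂]`. -/
theorem IsSystem.exists_roots (h : IsSystem α₁ β₁ α₂ β₂ μ₁ μ₂) {n : ℕ × ℕ} {p : ℝ[X]}
    (hp : IsTypeII μ₁ μ₂ n p) :
    ∃ (s : Finset ℝ) (Y : Multiset ℝ), s.card = n.1 ∧ Y.card = n.2 ∧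
      (∀ x ∈ s, x ∈ Icc α₁ β₁) ∧ (∀ y ∈ Y, y ∈ Icc α₂ β₂) ∧
      p = (∏ x ∈ s, (X - C x)) * (Y.map fun y => X - C y).prod ∧
      zerosOn p α₁ β₁ = s.val ∧ cofactorOn p α₁ β₁ = (Y.map fun y => X - C y).prod := by
  classical
  obtain ⟨hm, hd, o1, o2⟩ := hp
  have := h.finite₁
  have := h.finite₂
  have c1 := le_card_oddRoots h.ac₁ h.ne_zero₁ h.supp₁ hm.ne_zero o1
  have c2 := le_card_oddRoots h.ac₂ h.ne_zero₂ h.supp₂ hm.ne_zero o2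
  have l1 := oddRoots_val_le p α₁ β₁
  have l2 := oddRoots_val_le p α₂ β₂
  have d1 := Multiset.card_le_card l1
  have d2 := Multiset.card_le_card l2
  have l3 := h.le_card_filter_add p.roots
  have d3 := Multiset.card_le_card l3
  rw [Multiset.card_add] at d3
  rw [Finset.card_val] at d1 d2
  have d4 := card_roots' p
  -- The two intervals already carry at least `n₁ + n₂ = deg p` zeros, so every inequality in the
  -- count is an equality.
  have e1 := Multiset.eq_of_le_of_card_le l1 (by rw [Finset.card_val]; omega)
  have e3 := Multiset.eq_of_le_of_card_le l3 (by rw [Multiset.card_add]; omega)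
  have hz : zerosOn p α₁ β₁ = (oddRoots p α₁ β₁).val := by
    rw [e1, zerosOn]
  have hprod := prod_multiset_X_sub_C_of_monic_of_roots_card_eq hm (by omega)
  have hfac : p = (∏ x ∈ oddRoots p α₁ β₁, (X - C x)) *
      ((p.roots.filter fun c => c ∈ Icc α₂ β₂).map fun y => X - C y).prod := by
    conv_lhs => rw [← hprod, ← e3, ← e1, Multiset.map_add, Multiset.prod_add]
    rfl
  refine ⟨oddRoots p α₁ β₁, p.roots.filter fun c => c ∈ Icc α₂ β₂, by omega, by omega,
    fun x hx => ?_, fun y hy => (Multiset.mem_filter.mp hy).2, hfac, hz, ?_⟩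
  · have := Multiset.mem_of_le l1 hx
    exact (Multiset.mem_filter.mp this).2
  · have hmon : (∏ x ∈ oddRoots p α₁ β₁, (X - C x)).Monic := monic_prod_X_sub_C _ _
    have : factorOn p α₁ β₁ = ∏ x ∈ oddRoots p α₁ β₁, (X - C x) := by
      rw [factorOn, hz]; rfl
    rw [cofactorOn, this]
    exact (congrArg (· /ₘ _) hfac).trans (mul_divByMonic_cancel_left _ hmon)

/-- A polynomial of degree at most `|n| + 1` that is orthogonal with respect to both measures has
no double zeros. -/
theorem IsSystem.not_double_root (h : IsSystem α₁ β₁ α₂ β₂ μ₁ μ₂) {n : ℕ × ℕ} {Q : ℝ[X]}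
    (hQ0 : Q ≠ 0) (hd : Q.natDegree ≤ n.1 + n.2 + 1)
    (o1 : ∀ l < n.1, ∫ x, Q.eval x * x ^ l ∂μ₁ = 0)
    (o2 : ∀ l < n.2, ∫ x, Q.eval x * x ^ l ∂μ₂ = 0) {t : ℝ} (ht : Q.eval t = 0) :
    (derivative Q).eval t ≠ 0 := by
  classical
  intro ht'
  have := h.finite₁
  have := h.finite₂
  have c1 := le_card_oddRoots h.ac₁ h.ne_zero₁ h.supp₁ hQ0 o1
  have c2 := le_card_oddRoots h.ac₂ h.ne_zero₂ h.supp₂ hQ0 o2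
  set T := oddRoots Q α₁ β₁ ∪ oddRoots Q α₂ β₂ with hT
  have hdisj : Disjoint (oddRoots Q α₁ β₁) (oddRoots Q α₂ β₂) := by
    rw [Finset.disjoint_left]
    intro c hc hc'
    simp only [oddRoots, Finset.mem_filter] at hc hc'
    linarith [hc.2.1.2, hc'.2.1.1, h.lt₁₂]
  have hTc : n.1 + n.2 ≤ T.card := by
    rw [hT, Finset.card_union_of_disjoint hdisj]; omega
  have hodd : ∀ c ∈ T, Odd (Q.roots.count c) := by
    intro c hc
    rw [hT, Finset.mem_union] at hc
    rcases hc with hc | hc <;>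
    · simp only [oddRoots, Finset.mem_filter] at hc
      exact hc.2.2
  have h2 : 2 ≤ Q.roots.count t := by
    rw [count_roots]
    exact (one_lt_rootMultiplicity_iff_isRoot hQ0).mpr ⟨ht, ht'⟩
  -- A double zero outside `T` adds two to the count; one inside `T` has odd multiplicity at least
  -- two, hence at least three. Either way there are `|n| + 2` zeros, one more than the degree
  -- allows.
  have hle : T.val + Multiset.replicate 2 t ≤ Q.roots := by
    rw [Multiset.le_iff_count]
    intro c
    rw [Multiset.count_add, Multiset.count_replicate]
    by_cases hc : c ∈ T
    · have h3 : Multiset.count c T.val = 1 := Multiset.count_eq_one_of_mem T.nodup hc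
      have h4 := hodd c hc
      have h5 := h4.pos
      rw [h3]
      split_ifs with h6
      · subst h6
        obtain ⟨k, hk⟩ := h4
        omega
      · omega
    · have h3 : Multiset.count c T.val = 0 := Multiset.count_eq_zero_of_notMem hc
      rw [h3]
      split_ifs with h6
      · subst h6; omega
      · omega
  have h7 := Multiset.card_le_card hle
  have h8 := card_roots' Q
  rw [Multiset.card_add, Multiset.card_replicate, Finset.card_val] at h7
  omega

end Zeros

/-! ### Interlacing of zeros for neighbouring indices -/

section Interlacing

open Polynomial

variable {α₁ β₁ α₂ β₂ : ℝ} {μ₁ μ₂ : Measure ℝ}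

/-- A zero of the Wronskian at `t` yields a non-trivial combination of `p` and `q` with a double
zero at `t`. It has degree at most `|n| + 1` and inherits the orthogonality of index `n`, against
`IsSystem.not_double_root`. -/
theorem IsSystem.wronskian_ne_zero (h : IsSystem α₁ β₁ α₂ β₂ μ₁ μ₂) {n m : ℕ × ℕ} {p q : ℝ[X]}
    (hp : IsTypeII μ₁ μ₂ n p) (hq : IsTypeII μ₁ μ₂ m q) (h1 : n.1 ≤ m.1) (h2 : n.2 ≤ m.2)
    (hnm : m.1 + m.2 = n.1 + n.2 + 1) (t : ℝ) :
    p.eval t * (derivative q).eval t - (derivative p).eval t * q.eval t ≠ 0 := by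
  intro hW
  have := h.finite₁
  have := h.finite₂
  obtain ⟨v, hv0, hv⟩ := (Matrix.exists_mulVec_eq_zero_iff
    (M := !![p.eval t, q.eval t; (derivative p).eval t, (derivative q).eval t])).mpr
    (by rw [Matrix.det_fin_two_of]; linear_combination hW)
  have e0 := congrFun hv 0
  have e1 := congrFun hv 1
  simp only [Matrix.mulVec, dotProduct, Fin.sum_univ_two, Matrix.of_apply, Matrix.cons_val_zero,
    Matrix.cons_val_one, Pi.zero_apply] at e0 e1
  set Q : ℝ[X] := C (v 0) * p + C (v 1) * q with hQ
  have hQ0 : Q ≠ 0 := by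
    intro hQ'
    have c1 : v 1 = 0 := by
      have := congrArg (fun r => coeff r q.natDegree) hQ'
      simp only [hQ, coeff_add, coeff_C_mul, hq.1.coeff_natDegree, coeff_zero] at this
      rw [coeff_eq_zero_of_natDegree_lt (by rw [hp.2.1, hq.2.1]; omega)] at this
      simpa using this
    have c0 : v 0 = 0 := by
      rw [hQ, c1, C_0, zero_mul, add_zero, mul_eq_zero] at hQ'
      simpa [hp.1.ne_zero] using hQ'
    exact hv0 (funext fun i => by fin_cases i <;> simp [c0, c1])
  have hlin : ∀ (ν : Measure ℝ) (a b : ℝ) [IsFiniteMeasure ν], ν (Icc a b)ᶜ = 0 → ∀ l,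
      ∫ x, p.eval x * x ^ l ∂ν = 0 → ∫ x, q.eval x * x ^ l ∂ν = 0 →
      ∫ x, Q.eval x * x ^ l ∂ν = 0 := by
    intro ν a b _ hν l i1 i2
    have : ∀ x, Q.eval x * x ^ l = v 0 * (p.eval x * x ^ l) + v 1 * (q.eval x * x ^ l) := by
      intro x; simp only [hQ, eval_add, eval_mul, eval_C]; ring
    simp_rw [this]
    rw [integral_add, integral_const_mul, integral_const_mul, i1, i2, mul_zero, mul_zero, add_zero]
    · exact integrable_of_continuous_of_Icc hν (by fun_prop)
    · exact integrable_of_continuous_of_Icc hν (by fun_prop)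
  refine h.not_double_root (n := n) (t := t) hQ0 ?_
    (fun l hl => hlin μ₁ _ _ h.supp₁ l (hp.2.2.1 l hl) (hq.2.2.1 l (hl.trans_le h1)))
    (fun l hl => hlin μ₂ _ _ h.supp₂ l (hp.2.2.2 l hl) (hq.2.2.2 l (hl.trans_le h2))) ?_ ?_
  · refine natDegree_add_le_of_degree_le ((natDegree_C_mul_le _ _).trans ?_)
      ((natDegree_C_mul_le _ _).trans ?_)
    · rw [hp.2.1]; omega
    · rw [hq.2.1]; omega
  · simp only [hQ, eval_add, eval_mul, eval_C]; linear_combination e0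
  · simp only [hQ, derivative_add, derivative_C_mul, eval_add, eval_mul, eval_C]
    linear_combination e1

/-- Rolle's theorem for `p / q`, whose derivative is, up to sign, the Wronskian over `q²`. At the
endpoints `p` vanishes, so `q` cannot. -/
theorem exists_root_between {p q : ℝ[X]}
    (hW : ∀ t, p.eval t * (derivative q).eval t - (derivative p).eval t * q.eval t ≠ 0)
    {x y : ℝ} (hxy : x < y) (hx : p.eval x = 0) (hy : p.eval y = 0) :
    ∃ z ∈ Ioo x y, q.eval z = 0 := by
  by_contra! hq
  have hq' : ∀ z ∈ Icc x y, q.eval z ≠ 0 := by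
    intro z hz hz0
    rcases eq_or_lt_of_le hz.1 with rfl | h1
    · exact hW x (by rw [hx, hz0]; ring)
    · rcases eq_or_lt_of_le hz.2 with rfl | h2
      · exact hW z (by rw [hy, hz0]; ring)
      · exact hq z ⟨h1, h2⟩ hz0
  obtain ⟨c, hc, hc0⟩ := exists_deriv_eq_zero (f := fun t => p.eval t / q.eval t) hxy
    (p.continuous.continuousOn.div q.continuous.continuousOn hq') (by simp [hx, hy])
  have hqc := hq' c (Ioo_subset_Icc_self hc)
  have hd : HasDerivAt (fun t => p.eval t / q.eval t) _ c :=
    (p.hasDerivAt c).div (q.hasDerivAt c) hqc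
  rw [hd.deriv, div_eq_zero_iff] at hc0
  rcases hc0 with hc0 | hc0
  · exact hW c (by linear_combination -hc0)
  · exact hqc (pow_eq_zero_iff two_ne_zero |>.mp hc0)

/-- Sums of a monotone function with values in `[0, η]` over interlacing sets differ by at
most `η`. -/
theorem sum_le_sum_add_of_interlacing {A B : Finset ℝ} {g : ℝ → ℝ} {η : ℝ} (hη : 0 ≤ η)
    (hAB : ∀ x ∈ A, ∀ y ∈ A, x < y → ∃ z ∈ B, x < z ∧ z < y)
    (hg : ∀ x ∈ A ∪ B, ∀ y ∈ A ∪ B, x ≤ y → g x ≤ g y)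
    (h0 : ∀ x ∈ A ∪ B, 0 ≤ g x) (h1 : ∀ x ∈ A ∪ B, g x ≤ η) :
    ∑ x ∈ A, g x ≤ ∑ x ∈ B, g x + η := by
  -- Layer-cake representation: it reduces the sums to counting points in the superlevel sets `{g >
  -- s}`, `0 ≤ s ≤ η`.
  have hrep : ∀ x ∈ A ∪ B, g x = ∫ s in Icc 0 η, (Iio (g x)).indicator (fun _ => (1 : ℝ)) s := by
    intro x hx
    rw [integral_indicator_const _ measurableSet_Iio, smul_eq_mul, mul_one, measureReal_restrict_apply measurableSet_Iio]
    have : Iio (g x) ∩ Icc 0 η = Ico 0 (g x) := by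
      ext s
      simp only [mem_inter_iff, mem_Iio, mem_Icc, mem_Ico]
      have := h1 x hx
      constructor
      · rintro ⟨a, b, c⟩; exact ⟨b, a⟩
      · rintro ⟨a, b⟩; exact ⟨b, a, by linarith⟩
    rw [this, Real.volume_real_Ico_of_le (h0 x hx), sub_zero]
  have hint : ∀ x, IntegrableOn (fun s => (Iio (g x)).indicator (fun _ => (1 : ℝ)) s)
      (Icc 0 η) := fun x =>
    (integrable_const (1 : ℝ)).indicator measurableSet_Iio
  have hcount : ∀ (T : Finset ℝ) (s : ℝ),
      ∑ x ∈ T, (Iio (g x)).indicator (fun _ => (1 : ℝ)) s = ({x ∈ T | s < g x} : Finset ℝ).card := by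
    intro T s
    simp only [indicator_apply, mem_Iio]
    rw [Finset.sum_boole]
  rw [Finset.sum_congr rfl fun x hx => hrep x (Finset.mem_union_left _ hx),
    Finset.sum_congr (s₁ := B) rfl fun x hx => hrep x (Finset.mem_union_right _ hx),
    ← integral_finsetSum _ fun x _ => hint x, ← integral_finsetSum _ fun x _ => hint x]
  have hη' : η = ∫ s in Icc 0 η, (1 : ℝ) := by
    simp [hη]
  refine le_of_le_of_eq ?_ (congrArg (_ + ·) hη'.symm)
  rw [← integral_add (integrable_finsetSum _ fun x _ => hint x) (integrable_const _)]
  refine integral_mono (integrable_finsetSum _ fun x _ => hint x)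
    ((integrable_finsetSum _ fun x _ => hint x).add (integrable_const _)) fun s => ?_
  simp only
  rw [hcount, hcount]
  norm_cast
  -- By monotonicity a superlevel set contains the points of `B` lying between two of its points
  -- from `A`. Thus interlacing survives the restriction and the counts differ by at most one;
  -- integration over `[0, η]` turns this one into `η`.
  refine Finset.card_le_of_interleaved fun x hx y hy hxy _ => ?_
  rw [Finset.mem_filter] at hx hy
  obtain ⟨z, hz, hxz, hzy⟩ := hAB x hx.1 y hy.1 hxy
  exact ⟨z, Finset.mem_filter.mpr ⟨hz, hx.2.trans_le (hg x (Finset.mem_union_left _ hx.1) z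
    (Finset.mem_union_right _ hz) hxz.le)⟩, hxz, hzy⟩

end Interlacing

/-! ### Exponential estimate for zeros away from the left endpoint -/

section ZerosConverge


/-- The primitive `x log x - x` is bounded on bounded sets, so the logarithmic singularity costs
only a constant, uniformly in its position. -/
theorem exists_le_integral_log_abs_sub (a b : ℝ) (hab : a < b) (D : ℝ) :
    ∃ C : ℝ, 0 ≤ C ∧ ∀ y, |a - y| ≤ D → |b - y| ≤ D →
      -C ≤ ∫ x in a..b, Real.log |x - y| := by
  obtain ⟨K, hK⟩ := (isCompact_Icc (a := -D) (b := D)).exists_bound_of_continuousOn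
    Real.continuous_mul_log.continuousOn
  refine ⟨2 * |K| + (b - a), by have := abs_nonneg K; linarith, fun y ha hb => ?_⟩
  simp_rw [Real.log_abs]
  rw [intervalIntegral.integral_comp_sub_right Real.log y, integral_log]
  have h1 := abs_le.mp ((hK (a - y) (abs_le.mp ha)).trans (le_abs_self K))
  have h2 := abs_le.mp ((hK (b - y) (abs_le.mp hb)).trans (le_abs_self K))
  linarith [h1.2, h2.1]

/-- The square of a monic polynomial with zeros at a bounded distance from `[a, b]` has an
integral that is at least exponentially small in the degree. -/
theorem exists_le_integral_prod_sq (a b : ℝ) (hab : a < b) (D : ℝ) :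
    ∃ c : ℝ, 0 < c ∧ c ≤ 1 ∧ ∀ T : Finset ℝ, (∀ y ∈ T, |a - y| ≤ D ∧ |b - y| ≤ D) →
      (b - a) * c ^ T.card ≤ ∫ x in Icc a b, ((∏ y ∈ T, (Polynomial.X - Polynomial.C y) : Polynomial ℝ).eval x) ^ 2 := by
  obtain ⟨C, hC0, hC⟩ := exists_le_integral_log_abs_sub a b hab D
  have hba : 0 < b - a := sub_pos.mpr hab
  refine ⟨Real.exp (-(2 * C / (b - a))), Real.exp_pos _, Real.exp_le_one_iff.mpr ?_,
    fun T hT => ?_⟩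
  · have : 0 ≤ 2 * C / (b - a) := by positivity
    linarith
  set ν := (volume : Measure ℝ).restrict (Icc a b) with hν
  have hν0 : ν.real univ = b - a := by
    rw [hν, measureReal_restrict_apply_univ, Real.volume_real_Icc_of_le hab.le]
  have : NeZero ν := ⟨fun h => by rw [h] at hν0; simp at hν0; linarith⟩
  set f : ℝ → ℝ := fun x => ∑ y ∈ T, 2 * Real.log |x - y| with hf
  have hlog : ∀ y, Integrable (fun x => Real.log |x - y|) ν := by
    intro y
    simp_rw [Real.log_abs]
    have := (intervalIntegral.intervalIntegrable_log' (a := a - y) (b := b - y)).comp_sub_right y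
    simp only [sub_add_cancel] at this
    rw [intervalIntegrable_iff_integrableOn_Icc_of_le hab.le] at this
    exact this
  have hfi : Integrable f ν := integrable_finsetSum _ fun y _ => (hlog y).const_mul 2
  have hexp : (fun x => ((∏ y ∈ T, (Polynomial.X - Polynomial.C y) : Polynomial ℝ).eval x) ^ 2) =ᵐ[ν] Real.exp ∘ f := by
    have hne : ∀ᵐ x ∂ν, x ∉ (T : Set ℝ) :=
      ae_restrict_of_ae (measure_eq_zero_iff_ae_notMem.mp (T.finite_toSet.measure_zero volume))
    filter_upwards [hne] with x hx
    rw [Function.comp, hf, Real.exp_sum, Polynomial.eval_prod, ← Finset.prod_pow]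
    refine Finset.prod_congr rfl fun y hy => ?_
    have hxy : x - y ≠ 0 := fun h => hx (by rw [sub_eq_zero.mp h]; exact hy)
    rw [Polynomial.eval_sub, Polynomial.eval_X, Polynomial.eval_C, two_mul, Real.exp_add, Real.exp_log (abs_pos.mpr hxy),
      abs_mul_abs_self, sq]
  have hgi : Integrable (Real.exp ∘ f) ν :=
    Integrable.congr ((by fun_prop : Continuous fun x : ℝ =>
      ((∏ y ∈ T, (Polynomial.X - Polynomial.C y) : Polynomial ℝ).eval x) ^ 2).continuousOn.integrableOn_Icc) hexp
  -- Jensen's inequality for `exp` reduces the bound to the integrals of `log |x - y|`, one for each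
  -- zero.
  have hJ := convexOn_exp.map_average_le Real.continuous_exp.continuousOn isClosed_univ
    (by simp) hfi hgi
  rw [average_eq, average_eq, hν0, smul_eq_mul, smul_eq_mul] at hJ
  rw [integral_congr_ae hexp]
  have hlow : -(2 * C * T.card) ≤ ∫ x, f x ∂ν := by
    rw [hf, integral_finsetSum _ fun y _ => (hlog y).const_mul 2]
    have : ∀ y ∈ T, -(2 * C) ≤ ∫ x, 2 * Real.log |x - y| ∂ν := by
      intro y hy
      have h3 := hC y (hT y hy).1 (hT y hy).2
      rw [intervalIntegral.integral_of_le hab.le, ← integral_Icc_eq_integral_Ioc] at h3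
      rw [integral_const_mul]
      linarith
    refine le_trans (le_of_eq ?_) (Finset.card_nsmul_le_sum _ _ _ this)
    rw [nsmul_eq_mul]; ring
  have hle : Real.exp (-(2 * C / (b - a))) ^ T.card ≤ Real.exp ((b - a)⁻¹ * ∫ x, f x ∂ν) := by
    rw [← Real.exp_nat_mul]
    refine Real.exp_le_exp.mpr ?_
    calc (T.card : ℝ) * -(2 * C / (b - a)) = (b - a)⁻¹ * -(2 * C * T.card) := by
          field_simp
      _ ≤ _ := mul_le_mul_of_nonneg_left hlow (inv_nonneg.mpr hba.le)
  calc (b - a) * Real.exp (-(2 * C / (b - a))) ^ T.card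
      ≤ (b - a) * ((b - a)⁻¹ * ∫ x, Real.exp (f x) ∂ν) :=
        mul_le_mul_of_nonneg_left (hle.trans hJ) hba.le
    _ = ∫ x, (Real.exp ∘ f) x ∂ν := by
        rw [← mul_assoc, mul_inv_cancel₀ hba.ne', one_mul]; rfl


variable {α₁ β₁ α₂ β₂ : ℝ} {μ₁ μ₂ : Measure ℝ}

theorem eval_prod_X_sub_C_eq (Y : Multiset ℝ) (x : ℝ) :
    ((Y.map fun y => Polynomial.X - Polynomial.C y).prod : Polynomial ℝ).eval x =
      (-1) ^ Y.card * (Y.map fun y => y - x).prod := by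
  induction Y using Multiset.induction_on with
  | empty => simp
  | cons y Y ih =>
    rw [Multiset.map_cons, Multiset.prod_cons, Polynomial.eval_mul, ih, Multiset.map_cons,
      Multiset.prod_cons, Multiset.card_cons, pow_succ, Polynomial.eval_sub, Polynomial.eval_X,
      Polynomial.eval_C]
    ring

theorem pow_mul_prod_sub_le {Y : Multiset ℝ} {κ u v : ℝ} (hκ : 0 ≤ κ)
    (hY : ∀ y ∈ Y, 0 ≤ y - v ∧ κ * (y - v) ≤ y - u) :
    κ ^ Y.card * (Y.map fun y => y - v).prod ≤ (Y.map fun y => y - u).prod := by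
  have h : κ ^ Y.card * (Y.map fun y => y - v).prod = (Y.map fun y => κ * (y - v)).prod := by
    rw [Multiset.prod_map_mul, Multiset.map_const', Multiset.prod_replicate]
  rw [h]
  exact Multiset.prod_map_le_prod_map₀ _ _ (fun y hy => mul_nonneg hκ (hY y hy).1)
    fun y hy => (hY y hy).2

/-- If a multiple orthogonal polynomial has a zero on the first interval that is not close to its
left endpoint, then `n₂` is bounded by a multiple of `n₁ + 1`. -/
theorem IsSystem.exists_pow_le_of_root (h : IsSystem α₁ β₁ α₂ β₂ μ₁ μ₂) {m : ℝ} (hm : 0 < m)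
    (hden : ENNReal.ofReal m • volume.restrict (Icc α₁ β₁) ≤ μ₁) {ε : ℝ} (hε : 0 < ε) :
    ∃ C₀ C₁ κ : ℝ, 1 < κ ∧ 1 ≤ C₁ ∧ 0 ≤ C₀ ∧ ∀ (n : ℕ × ℕ) (p : Polynomial ℝ),
      IsTypeII μ₁ μ₂ n p →
      (∃ x ∈ Icc α₁ β₁, p.IsRoot x ∧ ε ≤ |x - α₁|) → κ ^ n.2 ≤ C₀ * C₁ ^ n.1 := by
  have := h.finite₁
  have l1 := h.lt₁
  have l12 := h.lt₁₂
  have l2 := h.lt₂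
  by_cases hεβ : β₁ < α₁ + ε
  · refine ⟨1, 1, 2, one_lt_two, le_rfl, zero_le_one, ?_⟩
    rintro n p - ⟨x, hx, -, hx'⟩
    rw [abs_of_nonneg (by linarith [hx.1])] at hx'
    linarith [hx.2]
  push Not at hεβ
  set u := α₁ + ε / 2 with hu
  set v := α₁ + ε with hv
  have hαu : α₁ < u := by linarith
  have huv : u < v := by linarith
  set D := β₁ - α₁ with hD
  have hD0 : 0 < D := by linarith
  obtain ⟨c, hc0, hc1, hc⟩ := exists_le_integral_prod_sq α₁ u hαu D
  set M := μ₁.real univ with hM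
  have hM0 : 0 ≤ M := measureReal_nonneg
  have hβv : 0 < β₂ - v := by linarith
  -- The ratio `(t - u) / (t - v)` decreases in `t > v`; this is its minimum over `[α₂, β₂]`.
  set κ := (β₂ - u) / (β₂ - v) with hκ
  have hκ1 : 1 < κ := by rw [hκ, one_lt_div hβv]; linarith
  -- The factors `ε / 2` are the least value of `y - x` on `[α₁, u]` and the length of that
  -- interval. The maximum with `1` lets the exponent `n₁ - 1`, the degree of `q`, be replaced by
  -- `n₁`.
  refine ⟨D * M / (ε / 2 * (m * (ε / 2))), max 1 (D ^ 2 / c), κ, hκ1, le_max_left _ _,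
    by positivity, ?_⟩
  rintro n p hp ⟨y, hy, hroot, hyε⟩
  rw [abs_of_nonneg (by linarith [hy.1])] at hyε
  have hvy : v ≤ y := by linarith
  obtain ⟨s, Y, hs, hY, hsI, hYI, hfac, hz, -⟩ := h.exists_roots hp
  have hys : y ∈ s := by
    rw [← Finset.mem_val, ← hz, zerosOn]
    exact Multiset.mem_filter.mpr ⟨(Polynomial.mem_roots hp.1.ne_zero).mpr hroot, hy⟩
  set q : Polynomial ℝ := ∏ x ∈ s.erase y, (Polynomial.X - Polynomial.C x) with hq
  set V : ℝ → ℝ := fun x => (Y.map fun t => t - x).prod with hV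
  have hk : (s.erase y).card + 1 = n.1 := by rw [Finset.card_erase_add_one hys, hs]
  set k := (s.erase y).card with hkdef
  have hpq : ∀ x, p.eval x * q.eval x = (-1) ^ (n.2 + 1) * ((y - x) * q.eval x ^ 2 * V x) := by
    intro x
    have e1 : p.eval x = (x - y) * q.eval x * ((-1) ^ n.2 * V x) := by
      conv_lhs => rw [hfac]
      rw [Polynomial.eval_mul, eval_prod_X_sub_C_eq, hY, ← Finset.mul_prod_erase s _ hys,
        Polynomial.eval_mul, Polynomial.eval_sub, Polynomial.eval_X, Polynomial.eval_C]
    rw [e1]; ring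
  have hVcont : Continuous V := by
    rw [hV]
    refine continuous_multiset_prod _ fun t _ => by fun_prop
  have hint0 : ∫ x, (y - x) * q.eval x ^ 2 * V x ∂μ₁ = 0 := by
    have hqd : q.natDegree < n.1 := by
      rw [hq, Polynomial.natDegree_prod_of_monic _ _ (fun c _ => Polynomial.monic_X_sub_C c),
        Finset.sum_congr rfl (fun c _ => Polynomial.natDegree_X_sub_C c),
        Finset.sum_const, smul_eq_mul, mul_one]
      omega
    have h0 := integral_mul_eq_zero_of_orthogonal h.supp₁ hp.2.2.1 hqd
    simp_rw [hpq] at h0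
    rw [integral_const_mul] at h0
    exact (mul_eq_zero.mp h0).resolve_left (pow_ne_zero _ (by norm_num))
  have hV0 : ∀ x ≤ β₁, 0 < V x := by
    intro x hx
    refine Multiset.prod_induction (fun a : ℝ => 0 < a) _ (fun _ _ => mul_pos) one_pos fun a ha => ?_
    obtain ⟨t, ht, rfl⟩ := Multiset.mem_map.mp ha
    linarith [(hYI t ht).1]
  have hVanti : ∀ x x', x ≤ x' → x' ≤ β₁ → V x' ≤ V x := by
    intro x x' hxx hx'
    refine Multiset.prod_map_le_prod_map₀ _ _ (fun t ht => ?_) fun t ht => by linarith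
    linarith [(hYI t ht).1]
  have hκV : κ ^ n.2 * V v ≤ V u := by
    rw [← hY]
    refine pow_mul_prod_sub_le (by positivity) fun t ht => ?_
    have ht := hYI t ht
    refine ⟨by linarith [ht.1], ?_⟩
    rw [hκ, div_mul_eq_mul_div, div_le_iff₀ hβv]
    nlinarith [ht.2]
  have hqD : ∀ x ∈ Icc α₁ β₁, q.eval x ^ 2 ≤ (D ^ 2) ^ k := by
    intro x hx
    rw [hq, Polynomial.eval_prod, ← Finset.prod_pow, hkdef, ← Finset.prod_const]
    refine Finset.prod_le_prod (fun t _ => sq_nonneg _) fun t ht => ?_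
    have ht := hsI t (Finset.mem_of_mem_erase ht)
    rw [Polynomial.eval_sub, Polynomial.eval_X, Polynomial.eval_C]
    refine sq_le_sq' ?_ ?_ <;> linarith [ht.1, ht.2, hx.1, hx.2]
  -- Pointwise lower bound: a gain of order `V u` on `[α₁, u]`, nothing lost between `u` and `y`, a
  -- loss of order `V v` beyond `y ≥ v`.
  have hpt : ∀ x ∈ Icc α₁ β₁, (Icc α₁ u).indicator (fun x => ε / 2 * V u * q.eval x ^ 2) x -
      D * (D ^ 2) ^ k * V v ≤ (y - x) * q.eval x ^ 2 * V x := by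
    intro x hx
    have hVv := hV0 v hεβ
    have hVx := hV0 x hx.2
    have hVu := hV0 u (huv.le.trans hεβ)
    have hpos : 0 ≤ D * (D ^ 2) ^ k * V v := by positivity
    by_cases hxu : x ≤ u
    · rw [indicator_of_mem (show x ∈ Icc α₁ u from ⟨hx.1, hxu⟩)]
      have h1 : ε / 2 * q.eval x ^ 2 * V u ≤ (y - x) * q.eval x ^ 2 * V x := by
        have := hVanti x u hxu (huv.le.trans hεβ)
        have h3 : ε / 2 ≤ y - x := by linarith
        gcongr
        exact mul_nonneg (by linarith) (sq_nonneg _)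
      linarith
    · rw [indicator_of_notMem (fun hx' => hxu hx'.2), zero_sub]
      by_cases hxy : x ≤ y
      · have : 0 ≤ (y - x) * q.eval x ^ 2 * V x :=
          mul_nonneg (mul_nonneg (by linarith) (sq_nonneg _)) hVx.le
        linarith
      · push Not at hxy
        have h1 : (x - y) * q.eval x ^ 2 * V x ≤ D * (D ^ 2) ^ k * V v := by
          have h2 := hVanti v x (by linarith) hx.2
          have h3 := hqD x hx
          have h4 : x - y ≤ D := by linarith [hx.2, hy.1]
          have h5 : 0 ≤ x - y := by linarith
          gcongr
        linarith
  have hmem : ∀ᵐ x ∂μ₁, x ∈ Icc α₁ β₁ := mem_ae_iff.mpr h.supp₁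
  have hI1 : Integrable (fun x => ε / 2 * V u * q.eval x ^ 2) μ₁ :=
    integrable_of_continuous_of_Icc h.supp₁ (by fun_prop)
  have hmono := integral_mono_ae ((hI1.indicator measurableSet_Icc).sub (integrable_const _))
    (integrable_of_continuous_of_Icc h.supp₁ (by fun_prop)) (hmem.mono hpt)
  simp only [Pi.sub_apply] at hmono
  rw [hint0, integral_sub (hI1.indicator measurableSet_Icc) (integrable_const _),
    integral_indicator measurableSet_Icc, integral_const_mul, integral_const, smul_eq_mul,
    ← hM] at hmono
  have hlow : m * ((u - α₁) * c ^ k) ≤ ∫ x in Icc α₁ u, q.eval x ^ 2 ∂μ₁ := by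
    have h1 : ENNReal.ofReal m • volume.restrict (Icc α₁ u) ≤ μ₁.restrict (Icc α₁ u) := by
      have h2 := Measure.restrict_mono (Subset.refl (Icc α₁ u)) hden
      rwa [Measure.restrict_smul, Measure.restrict_restrict measurableSet_Icc,
        inter_eq_left.mpr (Icc_subset_Icc_right (huv.le.trans hεβ))] at h2
    have h3 := integral_mono_measure h1 (Eventually.of_forall fun x => sq_nonneg (q.eval x))
      ((integrable_of_continuous_of_Icc h.supp₁ (by fun_prop)).integrableOn)
    rw [integral_smul_measure, ENNReal.toReal_ofReal hm.le, smul_eq_mul] at h3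
    refine le_trans (mul_le_mul_of_nonneg_left (hc _ fun t ht => ?_) hm.le) h3
    have ht := hsI t (Finset.mem_of_mem_erase ht)
    constructor <;> rw [abs_le] <;> constructor <;> linarith [ht.1, ht.2]
  have hVv := hV0 v hεβ
  have hu' : u - α₁ = ε / 2 := by rw [hu]; ring
  rw [hu'] at hlow
  have hfin : κ ^ n.2 * (ε / 2 * (m * (ε / 2)) * c ^ k) * V v ≤ D * M * (D ^ 2) ^ k * V v := by
    have h1 : ε / 2 * (κ ^ n.2 * V v) * (m * (ε / 2 * c ^ k)) ≤
        ε / 2 * V u * ∫ x in Icc α₁ u, q.eval x ^ 2 ∂μ₁ := by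
      have := hV0 u (huv.le.trans hεβ)
      gcongr
    linarith
  have hfin' := le_of_mul_le_mul_right hfin hVv
  have hck : 0 < c ^ k := by positivity
  calc κ ^ n.2 ≤ D * M * (D ^ 2) ^ k / (ε / 2 * (m * (ε / 2)) * c ^ k) := by
        rwa [le_div_iff₀ (by positivity)]
    _ = D * M / (ε / 2 * (m * (ε / 2))) * (D ^ 2 / c) ^ k := by
        rw [div_pow]; field_simp
    _ ≤ D * M / (ε / 2 * (m * (ε / 2))) * max 1 (D ^ 2 / c) ^ n.1 := by
        gcongr
        calc (D ^ 2 / c) ^ k ≤ max 1 (D ^ 2 / c) ^ k := by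
              gcongr; exact le_max_right _ _
          _ ≤ _ := pow_le_pow_right₀ (le_max_left _ _) (by omega)

end ZerosConverge

/-! ### Consequences of the hypotheses on the measures and of marginality -/

section Hypotheses

theorem HasAnalyticDensity.exists_smul_le {μ : Measure ℝ} {a b : ℝ} (hab : a < b)
    (h : HasAnalyticDensity μ a b) :
    ∃ m : ℝ, 0 < m ∧ ENNReal.ofReal m • volume.restrict (Icc a b) ≤ μ := by
  obtain ⟨U, f, hU, hIU, hf, -, hpos, rfl⟩ := h
  have hcont : ContinuousOn (fun x : ℝ => (f x).re) (Icc a b) :=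
    Complex.continuous_re.comp_continuousOn
      (hf.continuousOn.comp Complex.continuous_ofReal.continuousOn hIU)
  obtain ⟨x₀, hx₀, hmin⟩ := isCompact_Icc.exists_isMinOn (nonempty_Icc.mpr hab.le) hcont
  refine ⟨(f x₀).re, (hpos x₀ hx₀).2, ?_⟩
  rw [← withDensity_const]
  refine withDensity_mono ?_
  filter_upwards [ae_restrict_mem measurableSet_Icc] with x hx
  exact ENNReal.ofReal_le_ofReal (hmin hx)

theorem IsSzegoMeasure.ne_zero {μ : Measure ℝ} {a b : ℝ} (hab : a < b)
    (h : IsSzegoMeasure μ a b) : μ ≠ 0 := by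
  rintro rfl
  have h1 : ∀ᵐ x ∂volume.restrict (Icc a b), False := by
    filter_upwards [h.2.2.1, ae_restrict_of_ae (Measure.rnDeriv_zero (volume : Measure ℝ))]
      with x hx hx0
    rw [density, hx0] at hx
    simp at hx
  rw [eventually_false_iff_eq_bot, ae_eq_bot, Measure.restrict_eq_zero, Real.volume_Icc,
    ENNReal.ofReal_eq_zero] at h1
  linarith

theorem isSystem_of_analytic_of_szego {α₁ β₁ α₂ β₂ : ℝ} (h₁ : α₁ < β₁) (h₁₂ : β₁ < α₂)
    (h₂ : α₂ < β₂) {μ₁ μ₂ : Measure ℝ} [IsFiniteMeasure μ₁] [IsFiniteMeasure μ₂]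
    (hμ₁ : HasAnalyticDensity μ₁ α₁ β₁) (hμ₂ : IsSzegoMeasure μ₂ α₂ β₂) :
    IsSystem α₁ β₁ α₂ β₂ μ₁ μ₂ := by
  have hac : μ₁ ≪ volume.restrict (Icc α₁ β₁) := by
    obtain ⟨U, f, -, -, -, -, -, h⟩ := hμ₁
    rw [h]
    exact withDensity_absolutelyContinuous _ _
  refine ⟨h₁, h₁₂, h₂, inferInstance, inferInstance,
    hac.trans Measure.absolutelyContinuous_restrict, hμ₂.1, ?_, hμ₂.ne_zero h₂, hac ?_, hμ₂.2.1⟩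
  · rintro rfl
    obtain ⟨m, hm, hle⟩ := hμ₁.exists_smul_le h₁
    have h3 := hle univ
    simp only [Measure.smul_apply, Measure.restrict_apply_univ, Real.volume_Icc, smul_eq_mul,
      Measure.coe_zero, Pi.zero_apply, nonpos_iff_eq_zero, mul_eq_zero,
      ENNReal.ofReal_eq_zero] at h3
    rcases h3 with h3 | h3 <;> linarith
  · rw [Measure.restrict_apply measurableSet_Icc.compl, compl_inter_self, measure_empty]

theorem IsMarginal.tendsto_snd {N : Set (ℕ × ℕ)} (hN : IsMarginal N) :
    Tendsto (fun n : ℕ × ℕ => n.2) (along N) atTop := by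
  have h1 : Tendsto (fun n : ℕ × ℕ => n.1 + n.2) (along N) atTop :=
    tendsto_comap.mono_left inf_le_left
  rw [tendsto_atTop]
  intro k
  filter_upwards [tendsto_atTop.mp h1 (2 * k), hN.1, hN.2.eventually (gt_mem_nhds one_pos)]
    with n hn hpos hlt
  rw [div_lt_one (by exact_mod_cast hpos)] at hlt
  have : n.1 < n.2 := by exact_mod_cast hlt
  omega

/-- With `C₁ < κ ^ j` and `C₀ < κ ^ k` it is enough that `j n₁ + k ≤ n₂`. One half of `n₂` absorbs
`k`, the other half absorbs `j n₁`. -/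
theorem IsMarginal.eventually_lt_pow {N : Set (ℕ × ℕ)} (hN : IsMarginal N) {C₀ C₁ κ : ℝ}
    (hκ : 1 < κ) (hC₁ : 1 ≤ C₁) :
    ∀ᶠ n in along N, C₀ * C₁ ^ n.1 < κ ^ n.2 := by
  obtain ⟨j, hj⟩ := pow_unbounded_of_one_lt C₁ hκ
  obtain ⟨k, hk⟩ := pow_unbounded_of_one_lt C₀ hκ
  have hj0 : (0 : ℝ) < (2 * (j + 1) : ℝ)⁻¹ := by positivity
  filter_upwards [tendsto_atTop.mp hN.tendsto_snd (2 * k), hN.1,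
    hN.2.eventually (gt_mem_nhds hj0)] with n hn hpos hlt
  rw [div_lt_iff₀ (by exact_mod_cast hpos), inv_mul_eq_div, lt_div_iff₀ (by positivity)] at hlt
  have h1 : n.1 * (2 * (j + 1)) < n.2 := by exact_mod_cast hlt
  have h2 : j * n.1 + k ≤ n.2 := by nlinarith
  calc C₀ * C₁ ^ n.1 < κ ^ k * C₁ ^ n.1 := by gcongr
    _ ≤ κ ^ k * (κ ^ j) ^ n.1 := by gcongr
    _ = κ ^ (j * n.1 + k) := by rw [pow_add, pow_mul, mul_comm]
    _ ≤ κ ^ n.2 := pow_le_pow_right₀ hκ.le h2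

theorem tendsto_add_along (N : Set (ℕ × ℕ)) (v : ℕ × ℕ) :
    Tendsto (fun n => n + v) (along N) (along ((fun n => n + v) '' N)) := by
  refine tendsto_inf.mpr ⟨tendsto_comap_iff.mpr ?_, ?_⟩
  · have h1 : Tendsto (fun n : ℕ × ℕ => n.1 + n.2) (along N) atTop :=
      tendsto_comap.mono_left inf_le_left
    refine tendsto_atTop_mono (fun n => ?_) h1
    simp only [Function.comp, Prod.fst_add, Prod.snd_add]
    omega
  · exact (tendsto_principal_principal.mpr fun n hn => mem_image_of_mem _ hn).mono_left inf_le_right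

variable {α₁ β₁ α₂ β₂ : ℝ} {μ₁ μ₂ : Measure ℝ}

/-- The zeros on the first interval tend to its left endpoint; the index may be shifted. -/
theorem IsSystem.eventually_root_near (h : IsSystem α₁ β₁ α₂ β₂ μ₁ μ₂)
    (hμ₁ : HasAnalyticDensity μ₁ α₁ β₁) {P : ℕ × ℕ → Polynomial ℝ}
    (hP : ∀ n, IsTypeII μ₁ μ₂ n (P n)) {N : Set (ℕ × ℕ)} (hN : IsMarginal N) (v : ℕ × ℕ)
    {ε : ℝ} (hε : 0 < ε) :
    ∀ᶠ n in along N, ∀ x ∈ Icc α₁ β₁, (P (n + v)).IsRoot x → |x - α₁| < ε := by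
  obtain ⟨m, hm, hden⟩ := hμ₁.exists_smul_le h.lt₁
  obtain ⟨C₀, C₁, κ, hκ, hC₁, hC₀, hb⟩ := h.exists_pow_le_of_root hm hden hε
  -- The index shift only changes the constant: `C₁ ^ v.1` is absorbed in `C₀`, and `κ ^ v.2 ≥ 1`
  -- helps.
  filter_upwards [hN.eventually_lt_pow (C₀ := C₀ * C₁ ^ v.1) hκ hC₁] with n hn x hx hroot
  by_contra! hlt
  have h1 := hb (n + v) _ (hP _) ⟨x, hx, hroot, hlt⟩
  rw [Prod.fst_add, Prod.snd_add] at h1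
  have h2 : κ ^ n.2 ≤ κ ^ (n.2 + v.2) := pow_le_pow_right₀ hκ.le (by omega)
  rw [pow_add C₁] at h1
  linarith

end Hypotheses

/-! ### Monotonicity of `φ₂` on the first interval -/

section RealPhi

/-- The restriction of `φ` to the real half-line left of `[a, b]`. -/
def phiReal (a b x : ℝ) : ℝ :=
  (x - (a + b) / 2) * (1 + Real.sqrt (1 - (((b - a) / 2) / (x - (a + b) / 2)) ^ 2)) / 2

theorem sq_div_sub_le_one {a b x : ℝ} (hab : a < b) (hx : x < a) :
    (((b - a) / 2) / (x - (a + b) / 2)) ^ 2 ≤ 1 := by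
  rw [sq_le_one_iff_abs_le_one, abs_div, div_le_one (by rw [abs_pos]; linarith),
    abs_of_pos (by linarith), abs_of_neg (by linarith)]
  linarith

theorem phi_ofReal {a b x : ℝ} (hab : a < b) (hx : x < a) : phi a b x = phiReal a b x := by
  have h0 : 0 ≤ 1 - (((b - a) / 2) / (x - (a + b) / 2)) ^ 2 :=
    sub_nonneg.mpr (sq_div_sub_le_one hab hx)
  have h1 : (1 - ((((b - a) / 2 : ℝ) : ℂ) / ((x : ℂ) - ((a + b) / 2 : ℝ))) ^ 2) ^ (1 / 2 : ℂ) =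
      (Real.sqrt (1 - (((b - a) / 2) / (x - (a + b) / 2)) ^ 2) : ℝ) := by
    rw [Real.sqrt_eq_rpow, Complex.ofReal_cpow h0]
    push_cast
    rfl
  rw [phi, w, h1, phiReal]
  push_cast
  ring

/-- The linear factor is negative and increases, while the factor `1 + √…` is positive and
decreases. -/
theorem phiReal_mono {a b x y : ℝ} (hab : a < b) (hxy : x ≤ y) (hy : y < a) :
    phiReal a b x ≤ phiReal a b y := by
  have hsq : (((b - a) / 2) / (x - (a + b) / 2)) ^ 2 ≤
      (((b - a) / 2) / (y - (a + b) / 2)) ^ 2 := by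
    rw [div_pow _ (x - (a + b) / 2), div_pow _ (y - (a + b) / 2)]
    have : 0 < (y - (a + b) / 2) ^ 2 := by
      have : y - (a + b) / 2 ≠ 0 := by
        intro h; linarith
      positivity
    refine div_le_div_of_nonneg_left (sq_nonneg _) this ?_
    nlinarith
  have hs := Real.sqrt_le_sqrt (sub_le_sub_left hsq 1)
  have hs0 := Real.sqrt_nonneg (1 - (((b - a) / 2) / (x - (a + b) / 2)) ^ 2)
  have hs1 := Real.sqrt_nonneg (1 - (((b - a) / 2) / (y - (a + b) / 2)) ^ 2)
  rw [phiReal, phiReal]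
  nlinarith

theorem continuousAt_phiReal {a b x : ℝ} (hab : a < b) (hx : x < a) :
    ContinuousAt (phiReal a b) x := by
  unfold phiReal
  have : x - (a + b) / 2 ≠ 0 := by
    intro h; linarith
  fun_prop (disch := assumption)

variable {α₁ β₁ α₂ β₂ : ℝ} {μ₁ μ₂ : Measure ℝ}

open Polynomial in
-- Interlacing holds in both directions because the Wronskian only changes sign when `p` and `q` are
-- exchanged. The bound does not depend on the number of zeros.
theorem IsSystem.abs_sum_phiReal_sub_le (h : IsSystem α₁ β₁ α₂ β₂ μ₁ μ₂) {n m : ℕ × ℕ}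
    {p q : ℝ[X]} (hp : IsTypeII μ₁ μ₂ n p) (hq : IsTypeII μ₁ μ₂ m q) (h1 : n.1 ≤ m.1)
    (h2 : n.2 ≤ m.2) (hnm : m.1 + m.2 = n.1 + n.2 + 1) {s t : Finset ℝ}
    (hs : zerosOn p α₁ β₁ = s.val) (ht : zerosOn q α₁ β₁ = t.val) {η : ℝ} (hη : 0 ≤ η)
    (hsη : ∀ x ∈ s ∪ t, phiReal α₂ β₂ x - phiReal α₂ β₂ α₁ ≤ η) :
    |∑ x ∈ t, (phiReal α₂ β₂ x - phiReal α₂ β₂ α₁) -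
      ∑ x ∈ s, (phiReal α₂ β₂ x - phiReal α₂ β₂ α₁)| ≤ η := by
  have hms : ∀ x, x ∈ s ↔ p.eval x = 0 ∧ x ∈ Icc α₁ β₁ := by
    intro x
    rw [← Finset.mem_val, ← hs, zerosOn, Multiset.mem_filter, mem_roots hp.1.ne_zero, IsRoot.def]
  have hmt : ∀ x, x ∈ t ↔ q.eval x = 0 ∧ x ∈ Icc α₁ β₁ := by
    intro x
    rw [← Finset.mem_val, ← ht, zerosOn, Multiset.mem_filter, mem_roots hq.1.ne_zero, IsRoot.def]
  have hW := h.wronskian_ne_zero hp hq h1 h2 hnm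
  have hW' : ∀ t, q.eval t * (derivative p).eval t - (derivative q).eval t * p.eval t ≠ 0 :=
    fun t h0 => hW t (by linear_combination -h0)
  have hst : ∀ x ∈ s, ∀ y ∈ s, x < y → ∃ z ∈ t, x < z ∧ z < y := by
    intro x hx y hy hxy
    rw [hms] at hx hy
    obtain ⟨z, hz, hz0⟩ := exists_root_between hW hxy hx.1 hy.1
    exact ⟨z, (hmt z).mpr ⟨hz0, hx.2.1.trans hz.1.le, hz.2.le.trans hy.2.2⟩, hz.1, hz.2⟩
  have hts : ∀ x ∈ t, ∀ y ∈ t, x < y → ∃ z ∈ s, x < z ∧ z < y := by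
    intro x hx y hy hxy
    rw [hmt] at hx hy
    obtain ⟨z, hz, hz0⟩ := exists_root_between hW' hxy hx.1 hy.1
    exact ⟨z, (hms z).mpr ⟨hz0, hx.2.1.trans hz.1.le, hz.2.le.trans hy.2.2⟩, hz.1, hz.2⟩
  have hI : ∀ x ∈ s ∪ t, x ∈ Icc α₁ β₁ := by
    intro x hx
    rcases Finset.mem_union.mp hx with hx | hx
    · exact ((hms x).mp hx).2
    · exact ((hmt x).mp hx).2
  have hmono : ∀ x ∈ s ∪ t, ∀ y ∈ s ∪ t, x ≤ y →
      phiReal α₂ β₂ x - phiReal α₂ β₂ α₁ ≤ phiReal α₂ β₂ y - phiReal α₂ β₂ α₁ := by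
    intro x _ y hy hxy
    exact sub_le_sub_right (phiReal_mono h.lt₂ hxy ((hI y hy).2.trans_lt h.lt₁₂)) _
  have hnn : ∀ x ∈ s ∪ t, 0 ≤ phiReal α₂ β₂ x - phiReal α₂ β₂ α₁ := by
    intro x hx
    exact sub_nonneg.mpr (phiReal_mono h.lt₂ (hI x hx).1 ((hI x hx).2.trans_lt h.lt₁₂))
  have k1 := sum_le_sum_add_of_interlacing hη hst hmono hnn hsη
  rw [Finset.union_comm] at hmono hnn hsη
  have k2 := sum_le_sum_add_of_interlacing hη hts hmono hnn hsη
  rw [abs_le]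
  constructor <;> linarith

end RealPhi

/-! ### Expansions at infinity -/

section Infinity

/-- `f(z) = 1 + c / z + o(1 / z)` as `z → ∞`. -/
def HasInvCoeff (f : ℂ → ℂ) (c : ℂ) : Prop :=
  Tendsto (fun z => z * (f z - 1)) (Bornology.cobounded ℂ) (𝓝 c)

theorem HasInvCoeff.congr' {f g : ℂ → ℂ} {c : ℂ} (hf : HasInvCoeff f c)
    (h : f =ᶠ[Bornology.cobounded ℂ] g) : HasInvCoeff g c :=
  Tendsto.congr' (h.mono fun z hz => by simp only [hz]) hf

theorem HasInvCoeff.tendsto_one {f : ℂ → ℂ} {c : ℂ} (hf : HasInvCoeff f c) :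
    Tendsto f (Bornology.cobounded ℂ) (𝓝 1) := by
  have h1 := (tendsto_inv₀_cobounded (α := ℂ)).mul hf
  rw [zero_mul] at h1
  have h2 := h1.add_const 1
  rw [zero_add] at h2
  refine h2.congr' ?_
  filter_upwards [Bornology.eventually_ne_cobounded (0 : ℂ)] with z hz
  field_simp
  ring

theorem hasInvCoeff_one : HasInvCoeff (fun _ => 1) 0 := by
  simp [HasInvCoeff]

theorem HasInvCoeff.mul {f g : ℂ → ℂ} {c d : ℂ} (hf : HasInvCoeff f c) (hg : HasInvCoeff g d) :
    HasInvCoeff (fun z => f z * g z) (c + d) := by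
  have h := (Tendsto.mul hf hg.tendsto_one).add hg
  rw [mul_one] at h
  exact h.congr fun z => by ring

theorem HasInvCoeff.inv {f : ℂ → ℂ} {c : ℂ} (hf : HasInvCoeff f c) :
    HasInvCoeff (fun z => (f z)⁻¹) (-c) := by
  have h := (Tendsto.mul hf (hf.tendsto_one.inv₀ one_ne_zero)).neg
  rw [inv_one, mul_one] at h
  refine h.congr' ?_
  filter_upwards [hf.tendsto_one.eventually_ne one_ne_zero] with z hz
  field_simp
  ring

theorem HasInvCoeff.div {f g : ℂ → ℂ} {c d : ℂ} (hf : HasInvCoeff f c) (hg : HasInvCoeff g d) :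
    HasInvCoeff (fun z => f z / g z) (c - d) := by
  simpa only [div_eq_mul_inv, sub_eq_add_neg] using hf.mul hg.inv

theorem hasInvCoeff_multiset_prod {f : ℝ → ℂ → ℂ} {c : ℝ → ℂ} (s : Multiset ℝ)
    (h : ∀ x ∈ s, HasInvCoeff (f x) (c x)) :
    HasInvCoeff (fun z => (s.map fun x => f x z).prod) (s.map c).sum := by
  induction s using Multiset.induction_on with
  | empty => simpa using hasInvCoeff_one
  | cons x s ih =>
    simp only [Multiset.map_cons, Multiset.prod_cons, Multiset.sum_cons]
    exact (h x (Multiset.mem_cons_self x s)).mul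
      (ih fun y hy => h y (Multiset.mem_cons_of_mem hy))

theorem HasInvCoeff.pow {f : ℂ → ℂ} {c : ℂ} (hf : HasInvCoeff f c) (n : ℕ) :
    HasInvCoeff (fun z => f z ^ n) (n * c) := by
  induction n with
  | zero => simpa using hasInvCoeff_one
  | succ n ih =>
    simp only [pow_succ]
    convert ih.mul hf using 1
    push_cast; ring

/-- If `f` is holomorphic and `ε`-close to `1` near infinity, then the coefficient of `1 / z` in its
expansion is `O(ε)`. -/
theorem HasInvCoeff.norm_le {f : ℂ → ℂ} {c : ℂ} (hf : HasInvCoeff f c) {R ε : ℝ} (hR : 0 < R)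
    (hd : ∀ z : ℂ, R < ‖z‖ → DifferentiableAt ℂ f z) (hε : ∀ z : ℂ, R < ‖z‖ → ‖f z - 1‖ ≤ ε) :
    ‖c‖ ≤ R * ε := by
  -- In the coordinate `ζ = 1/z` the singularity at `0` is removable. The Schwarz lemma on the disk
  -- of radius `R⁻¹` then gives `|h(ζ)| ≤ ε R |ζ|`.
  set h : ℂ → ℂ := Function.update (fun ζ => f ζ⁻¹ - 1) 0 0 with hh
  have hball : ∀ ζ ∈ Metric.ball (0 : ℂ) R⁻¹, ζ ≠ 0 → R < ‖ζ⁻¹‖ := by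
    intro ζ hζ h0
    rw [mem_ball_zero_iff] at hζ
    rw [norm_inv, lt_inv_comm₀ hR (norm_pos_iff.mpr h0)]
    exact hζ
  have h0 : (0 : ℂ) ∈ Metric.ball (0 : ℂ) R⁻¹ := Metric.mem_ball_self (inv_pos.mpr hR)
  have hcont : ContinuousAt h 0 := by
    rw [hh, continuousAt_update_same]
    have h1 := (hf.tendsto_one.comp (tendsto_inv₀_nhdsNE_zero (α := ℂ))).sub_const 1
    rwa [sub_self] at h1
  have hdiff : DifferentiableOn ℂ h (Metric.ball 0 R⁻¹) := by
    refine (Complex.differentiableOn_compl_singleton_and_continuousAt_iff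
      (Metric.isOpen_ball.mem_nhds h0)).mp ⟨fun ζ hζ => ?_, hcont⟩
    have hζ0 : ζ ≠ 0 := hζ.2
    have h1 : DifferentiableAt ℂ (fun ζ : ℂ => f ζ⁻¹ - 1) ζ :=
      ((hd _ (hball ζ hζ.1 hζ0)).comp ζ (differentiableAt_inv hζ0)).sub_const 1
    refine (h1.congr_of_eventuallyEq ?_).differentiableWithinAt
    filter_upwards [isOpen_ne.mem_nhds hζ0] with y hy
    rw [hh, Function.update_of_ne hy]
  have hmaps : MapsTo h (Metric.ball 0 R⁻¹) (Metric.closedBall (h 0) ε) := by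
    have hε0 : 0 ≤ ε := (norm_nonneg _).trans (hε ((R + 1 : ℝ) : ℂ) (by
      rw [Complex.norm_real, Real.norm_of_nonneg (by linarith)]; linarith))
    intro ζ hζ
    have h00 : h 0 = 0 := by rw [hh, Function.update_self]
    rw [h00, mem_closedBall_zero_iff]
    by_cases hζ0 : ζ = 0
    · rw [hζ0, h00, norm_zero]; exact hε0
    · rw [hh, Function.update_of_ne hζ0]
      exact hε _ (hball ζ hζ hζ0)
  refine le_of_tendsto hf.norm ?_
  have hlarge : ∀ᶠ z : ℂ in Bornology.cobounded ℂ, R < ‖z‖ :=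
    tendsto_norm_cobounded_atTop.eventually_gt_atTop R
  filter_upwards [hlarge] with z hz
  have hzpos : 0 < ‖z‖ := hR.trans hz
  have hz0 : z ≠ 0 := norm_pos_iff.mp hzpos
  have hmem : z⁻¹ ∈ Metric.ball (0 : ℂ) R⁻¹ := by
    rw [mem_ball_zero_iff, norm_inv]
    exact inv_strictAnti₀ hR hz
  have key := Complex.dist_le_div_mul_dist_of_mapsTo_ball hdiff hmaps hmem
  rw [hh, Function.update_of_ne (inv_ne_zero hz0), Function.update_self, dist_zero_right,
    dist_zero_right, inv_inv, norm_inv, div_inv_eq_mul] at key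
  rw [norm_mul]
  calc ‖z‖ * ‖f z - 1‖ ≤ ‖z‖ * (ε * R * ‖z‖⁻¹) := mul_le_mul_of_nonneg_left key hzpos.le
    _ = R * ε := by field_simp

theorem hasInvCoeff_sub_div (y : ℂ) : HasInvCoeff (fun z => (z - y) / z) (-y) := by
  refine tendsto_const_nhds.congr' ?_
  filter_upwards [Bornology.eventually_ne_cobounded (0 : ℂ)] with z hz
  field_simp
  ring

theorem tendsto_phi_div (a b : ℝ) :
    Tendsto (fun z => phi a b z / z) (Bornology.cobounded ℂ) (𝓝 1) := by
  have h := (((hasInvCoeff_sub_div ((a + b) / 2 : ℝ)).tendsto_one.add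
    (tendsto_w_div a b)).div_const 2)
  rw [show ((1 : ℂ) + 1) / 2 = 1 by norm_num] at h
  refine h.congr fun z => ?_
  rw [phi]; ring

theorem eventually_notMem_Icc (a b : ℝ) :
    ∀ᶠ z : ℂ in Bornology.cobounded ℂ, ∀ x ∈ Icc a b, (x : ℂ) ≠ z := by
  filter_upwards [tendsto_norm_cobounded_atTop.eventually_gt_atTop (max |a| |b|)] with z hz x hx h
  rw [← h, Complex.norm_real, Real.norm_eq_abs] at hz
  exact absurd (abs_le_max_abs_abs hx.1 hx.2) (not_le.mpr hz)

/-- The quadratic equation of `φ` reads `φ - z = -(a + b)/2 - A/φ`, and the last term vanishes at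
infinity. -/
theorem hasInvCoeff_phi_div (a b : ℝ) (hab : a < b) :
    HasInvCoeff (fun z => phi a b z / z) (-((a + b) / 2 : ℝ)) := by
  have h1 : Tendsto (fun z => -(((a + b) / 2 : ℝ) : ℂ) -
      constA a b * (z⁻¹ * (phi a b z / z)⁻¹)) (Bornology.cobounded ℂ)
      (𝓝 (-(((a + b) / 2 : ℝ) : ℂ) - constA a b * (0 * 1⁻¹))) :=
    tendsto_const_nhds.sub (((tendsto_inv₀_cobounded (α := ℂ)).mul
      ((tendsto_phi_div a b).inv₀ one_ne_zero)).const_mul _)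
  rw [zero_mul, mul_zero, sub_zero] at h1
  refine h1.congr' ?_
  filter_upwards [Bornology.eventually_ne_cobounded (0 : ℂ), eventually_notMem_Icc a b]
    with z hz hzI
  have hm : z ≠ ((a + b) / 2 : ℝ) := fun h =>
    hzI ((a + b) / 2) ⟨by linarith, by linarith⟩ h.symm
  have hq := phi_quadratic hm
  have hp : phi a b z ≠ 0 :=
    norm_pos_iff.mp ((by linarith : 0 < (b - a) / 4).trans (norm_phi_gt hab hzI))
  field_simp
  linear_combination -hq

/-- The function `S(·; x₀)` outside of `[a, b]`. -/
def sFun (a b : ℝ) (z : ℂ) (x₀ : ℝ) : ℂ :=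
  phi a b x₀ * phi a b z / (phi a b x₀ * phi a b z - constA a b)

theorem phi_ne_zero {a b : ℝ} {z : ℂ} (hab : a < b) (hz : ∀ x ∈ Icc a b, (x : ℂ) ≠ z) :
    phi a b z ≠ 0 :=
  norm_pos_iff.mp ((by linarith : 0 < (b - a) / 4).trans (norm_phi_gt hab hz))

theorem phi_mul_phi_sub_ne_zero {a b : ℝ} {z u : ℂ} (hab : a < b)
    (hz : ∀ x ∈ Icc a b, (x : ℂ) ≠ z) (hu : ∀ x ∈ Icc a b, (x : ℂ) ≠ u) :
    phi a b u * phi a b z - constA a b ≠ 0 := by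
  intro h
  have h1 := congrArg norm (sub_eq_zero.mp h)
  rw [norm_mul, Complex.norm_real, constA, Real.norm_of_nonneg (by positivity)] at h1
  have := norm_phi_gt hab hz
  have := norm_phi_gt hab hu
  nlinarith

theorem hasInvCoeff_sFun {a b x₀ : ℝ} (hab : a < b) (hx₀ : ∀ x ∈ Icc a b, (x : ℂ) ≠ x₀) :
    HasInvCoeff (fun z => sFun a b z x₀) (constA a b / phi a b x₀) := by
  have hp₀ := phi_ne_zero hab hx₀
  have h1 : Tendsto (fun z => constA a b / (phi a b x₀ * (phi a b z / z) - constA a b * z⁻¹))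
      (Bornology.cobounded ℂ) (𝓝 (constA a b / (phi a b x₀ * 1 - constA a b * 0))) :=
    tendsto_const_nhds.div (((tendsto_phi_div a b).const_mul _).sub
      ((tendsto_inv₀_cobounded (α := ℂ)).const_mul _)) (by simpa using hp₀)
  rw [mul_one, mul_zero, sub_zero] at h1
  refine h1.congr' ?_
  filter_upwards [Bornology.eventually_ne_cobounded (0 : ℂ), eventually_notMem_Icc a b]
    with z hz hzI
  have hd := phi_mul_phi_sub_ne_zero hab hzI hx₀
  rw [sFun]
  have e1 : phi a b x₀ * (phi a b z / z) - constA a b * z⁻¹ =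
      (phi a b x₀ * phi a b z - constA a b) / z := by
    field_simp
  rw [e1]
  field_simp
  ring

theorem differentiableAt_phi {a b : ℝ} {z : ℂ} (hab : a < b) (hz : ∀ x ∈ Icc a b, (x : ℂ) ≠ z) :
    DifferentiableAt ℂ (phi a b) z :=
  (hasDerivAt_phi hab hz).differentiableAt

theorem differentiableAt_sFun {a b x₀ : ℝ} {z : ℂ} (hab : a < b)
    (hz : ∀ x ∈ Icc a b, (x : ℂ) ≠ z) (hx₀ : ∀ x ∈ Icc a b, (x : ℂ) ≠ x₀) :
    DifferentiableAt ℂ (fun z => sFun a b z x₀) z := by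
  have := differentiableAt_phi hab hz
  unfold sFun
  exact (this.const_mul _).div ((this.const_mul _).sub_const _)
    (phi_mul_phi_sub_ne_zero hab hz hx₀)

theorem sFun_ne_zero {a b x₀ : ℝ} {z : ℂ} (hab : a < b)
    (hz : ∀ x ∈ Icc a b, (x : ℂ) ≠ z) (hx₀ : ∀ x ∈ Icc a b, (x : ℂ) ≠ x₀) :
    sFun a b z x₀ ≠ 0 :=
  div_ne_zero (mul_ne_zero (phi_ne_zero hab hx₀) (phi_ne_zero hab hz))
    (phi_mul_phi_sub_ne_zero hab hz hx₀)

end Infinity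

/-! ### Comparison of neighbouring polynomials through the asymptotic formula -/

section Ratio

open Polynomial

theorem aeval_prod_X_sub_C (M : Multiset ℝ) (z : ℂ) :
    aeval z (M.map fun y => X - C y).prod = (M.map fun y : ℝ => z - (y : ℂ)).prod := by
  rw [map_multiset_prod, Multiset.map_map]
  refine congrArg Multiset.prod (Multiset.map_congr rfl fun y _ => ?_)
  simp

theorem hasInvCoeff_aeval_div_pow (M : Multiset ℝ) :
    HasInvCoeff (fun z => aeval z (M.map fun y => X - C y).prod / z ^ M.card)
      (-(M.map fun y : ℝ => (y : ℂ)).sum) := by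
  have h := hasInvCoeff_multiset_prod (f := fun y z => (z - (y : ℂ)) / z)
    (c := fun y => -(y : ℂ)) M fun y _ => hasInvCoeff_sub_div y
  rw [Multiset.sum_map_neg] at h
  refine h.congr' (Eventually.of_forall fun z => ?_)
  simp only
  rw [aeval_prod_X_sub_C, Multiset.prod_map_div, Multiset.map_const', Multiset.prod_replicate]

theorem tendsto_aeval_div_sub (M M' : Multiset ℝ) (hM : M'.card = M.card + 1) :
    Tendsto (fun z : ℂ => aeval z (M'.map fun y => X - C y).prod /
        aeval z (M.map fun y => X - C y).prod - z) (Bornology.cobounded ℂ)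
      (𝓝 ((M.map fun y : ℝ => (y : ℂ)).sum - (M'.map fun y : ℝ => (y : ℂ)).sum)) := by
  have h := (hasInvCoeff_aeval_div_pow M').div (hasInvCoeff_aeval_div_pow M)
  rw [HasInvCoeff, neg_sub_neg] at h
  refine h.congr' ?_
  filter_upwards [Bornology.eventually_ne_cobounded (0 : ℂ),
    (hasInvCoeff_aeval_div_pow M).tendsto_one.eventually_ne one_ne_zero] with z hz hz'
  have h0 : aeval z (M.map fun y => X - C y).prod ≠ 0 := fun h => hz' (by rw [h, zero_div])
  rw [hM, pow_succ]
  field_simp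

/-- The quotient of `∏ (z - y)` by `(∏ S(z; x)) φ(z) ^ n`. -/
def normalized (a b : ℝ) (s : Finset ℝ) (Y : Multiset ℝ) (z : ℂ) : ℂ :=
  aeval z (Y.map fun y => X - C y).prod / ((∏ x ∈ s, sFun a b z x) * phi a b z ^ Y.card)

variable {a b : ℝ} {s : Finset ℝ} {Y : Multiset ℝ}

theorem hasInvCoeff_normalized (hab : a < b)
    (hs : ∀ x₀ ∈ s, ∀ x ∈ Icc a b, (x : ℂ) ≠ (x₀ : ℝ)) :
    HasInvCoeff (normalized a b s Y) (-(Y.map fun y : ℝ => (y : ℂ)).sum -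
      (∑ x ∈ s, (constA a b / phi a b x) + Y.card * -((a + b) / 2 : ℝ))) := by
  have h := (hasInvCoeff_aeval_div_pow Y).div ((hasInvCoeff_multiset_prod
    (f := fun x z => sFun a b z x) s.val fun x hx => hasInvCoeff_sFun hab (hs x hx)).mul
    ((hasInvCoeff_phi_div a b hab).pow Y.card))
  refine h.congr' ?_
  filter_upwards [Bornology.eventually_ne_cobounded (0 : ℂ)] with z hz
  have e : (Multiset.map (fun x => sFun a b z x) s.val).prod = ∏ x ∈ s, sFun a b z x := rfl
  rw [e, normalized, div_pow]
  have hz' : z ^ Y.card ≠ 0 := pow_ne_zero _ hz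
  rw [← mul_div_assoc, div_div_div_cancel_right₀ hz']

theorem normalized_denominator_ne_zero (hab : a < b) {z : ℂ} (hz : ∀ x ∈ Icc a b, (x : ℂ) ≠ z)
    (hs : ∀ x₀ ∈ s, ∀ x ∈ Icc a b, (x : ℂ) ≠ (x₀ : ℝ)) (n : ℕ) :
    (∏ x ∈ s, sFun a b z x) * phi a b z ^ n ≠ 0 :=
  mul_ne_zero (Finset.prod_ne_zero_iff.mpr fun x hx => sFun_ne_zero hab hz (hs x hx))
    (pow_ne_zero _ (phi_ne_zero hab hz))

theorem differentiableAt_normalized (hab : a < b) {z : ℂ} (hz : ∀ x ∈ Icc a b, (x : ℂ) ≠ z)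
    (hs : ∀ x₀ ∈ s, ∀ x ∈ Icc a b, (x : ℂ) ≠ (x₀ : ℝ)) :
    DifferentiableAt ℂ (normalized a b s Y) z := by
  unfold normalized
  refine DifferentiableAt.div (Polynomial.differentiable_aeval _ _) (DifferentiableAt.mul ?_
    ((differentiableAt_phi hab hz).pow _)) (normalized_denominator_ne_zero hab hz hs _)
  exact DifferentiableAt.fun_finsetProd fun x hx => differentiableAt_sFun hab hz (hs x hx)

theorem normalized_ne_zero (hab : a < b) {z : ℂ} (hz : ∀ x ∈ Icc a b, (x : ℂ) ≠ z)
    (hs : ∀ x₀ ∈ s, ∀ x ∈ Icc a b, (x : ℂ) ≠ (x₀ : ℝ)) (hY : ∀ y ∈ Y, y ∈ Icc a b) :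
    normalized a b s Y z ≠ 0 := by
  refine div_ne_zero ?_ (normalized_denominator_ne_zero hab hz hs _)
  rw [aeval_prod_X_sub_C]
  refine Multiset.prod_ne_zero fun h0 => ?_
  obtain ⟨y, hy, hy0⟩ := Multiset.mem_map.mp h0
  exact hz y (hY y hy) (sub_eq_zero.mp hy0).symm

/-- The asymptotic formula near infinity, in terms of `normalized`. -/
theorem VaryingAsymptotics.eventually_normalized {α₁ β₁ : ℝ} {μ₂ : Measure ℝ}
    {P : ℕ × ℕ → ℝ[X]} {N : Set (ℕ × ℕ)} (h : VaryingAsymptotics α₁ β₁ a b μ₂ P N) (hab : a < b)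
    {s : ℕ × ℕ → Finset ℝ} {Y : ℕ × ℕ → Multiset ℝ} (hYc : ∀ n, (Y n).card = n.2)
    (hs : ∀ n, ∀ x₀ ∈ s n, x₀ < a) (hz : ∀ n, zerosOn (P n) α₁ β₁ = (s n).val)
    (hcof : ∀ n, cofactorOn (P n) α₁ β₁ = ((Y n).map fun y => X - C y).prod)
    {R : ℝ} (hR : max |a| |b| < R) {ε : ℝ} (hε : 0 < ε) :
    ∀ᶠ n in along N, ∀ z : ℂ, R < ‖z‖ → ∃ o : ℂ, ‖o‖ ≤ ε ∧
      normalized a b (s n) (Y n) z = (1 + o) * (szego μ₂ a b z / szegoInf μ₂ a b) := by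
  have hball : ∀ x ∈ Icc a b, (x : ℂ) ∈ Metric.ball (0 : ℂ) R := by
    intro x hx
    rw [mem_ball_zero_iff, Complex.norm_real, Real.norm_eq_abs]
    exact (abs_le_max_abs_abs hx.1 hx.2).trans_lt hR
  -- This neighbourhood of `∞` is compact in the sphere, so the formula is uniform on all of `R <
  -- ‖z‖`.
  have hK : IsCompact ((fun z : ℂ => (z : OnePoint ℂ)) '' Metric.ball (0 : ℂ) R)ᶜ :=
    (OnePoint.isOpen_image_coe.mpr Metric.isOpen_ball).isClosed_compl.isCompact
  filter_upwards [h.2 _ hK (fun x hx hx' => hx' (mem_image_of_mem _ (hball x hx))) ε hε]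
    with n hn z hzR
  have hzI : ∀ x ∈ Icc a b, (x : ℂ) ≠ z := by
    intro x hx hxz
    have := hball x hx
    rw [hxz, mem_ball_zero_iff] at this
    exact lt_asymm this hzR
  obtain ⟨o, ho, heq⟩ := hn z (by
    rintro ⟨y, hy, hyz⟩
    rw [OnePoint.coe_injective hyz, mem_ball_zero_iff] at hy
    exact lt_asymm hy hzR)
  refine ⟨o, ho, ?_⟩
  have hsI : ∀ x₀ ∈ s n, ∀ x ∈ Icc a b, (x : ℂ) ≠ (x₀ : ℝ) := by
    intro x₀ hx₀ x hx hxx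
    have := hs n x₀ hx₀
    rw [Complex.ofReal_inj] at hxx
    linarith [hx.1]
  have hprod : ((zerosOn (P n) α₁ β₁).map fun x => S a b z x).prod =
      ∏ x ∈ s n, sFun a b z x := by
    rw [hz n]
    exact Finset.prod_congr rfl fun x hx => S_eq hab hzI fun hx' => by
      linarith [hs n x hx, hx'.1]
  rw [normalized, ← hcof, heq, hprod, hYc, mul_assoc]
  exact mul_div_cancel_right₀ _ (normalized_denominator_ne_zero hab hzI hsI _)

theorem szego_div_ne_zero (μ : Measure ℝ) (a b : ℝ) (z : ℂ) :
    szego μ a b z / szegoInf μ a b ≠ 0 :=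
  div_ne_zero (Complex.exp_ne_zero _) (Complex.exp_ne_zero _)

/-- `G` stands for the Szegő factor: it is the same at both indices and cancels, so nothing but its
non-vanishing is needed. -/
theorem norm_div_sub_one_le {o o' G : ℂ} {ε : ℝ} (hε : ε ≤ 1 / 2) (ho : ‖o‖ ≤ ε) (ho' : ‖o'‖ ≤ ε)
    (hG : G ≠ 0) : ‖(1 + o') * G / ((1 + o) * G) - 1‖ ≤ 4 * ε := by
  have h1 : 1 / 2 ≤ ‖1 + o‖ := by
    have := norm_sub_norm_le (1 : ℂ) (-o)
    rw [norm_one, norm_neg, sub_neg_eq_add] at this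
    linarith
  have h0 : 1 + o ≠ 0 := norm_pos_iff.mp (by linarith)
  have e : (1 + o') * G / ((1 + o) * G) - 1 = (o' - o) / (1 + o) := by
    field_simp
    ring
  rw [e, norm_div, div_le_iff₀ (by linarith)]
  have := norm_sub_le o' o
  have := (norm_nonneg o).trans ho
  nlinarith

/-- The coefficients of `1 / z` of `normalized` along `n` and `n + v` have the same behaviour. -/
theorem tendsto_coeff_sub {α₁ β₁ : ℝ} {μ₂ : Measure ℝ} {P : ℕ × ℕ → ℝ[X]} {N : Set (ℕ × ℕ)}
    {v : ℕ × ℕ} (hab : a < b) (h : VaryingAsymptotics α₁ β₁ a b μ₂ P N)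
    (h' : VaryingAsymptotics α₁ β₁ a b μ₂ P ((fun n => n + v) '' N))
    {s : ℕ × ℕ → Finset ℝ} {Y : ℕ × ℕ → Multiset ℝ} (hYc : ∀ n, (Y n).card = n.2)
    (hs : ∀ n, ∀ x₀ ∈ s n, x₀ < a) (hY : ∀ n, ∀ y ∈ Y n, y ∈ Icc a b)
    (hz : ∀ n, zerosOn (P n) α₁ β₁ = (s n).val)
    (hcof : ∀ n, cofactorOn (P n) α₁ β₁ = ((Y n).map fun y => X - C y).prod)
    {c : ℕ × ℕ → ℂ} (hc : ∀ n, HasInvCoeff (normalized a b (s n) (Y n)) (c n)) :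
    Tendsto (fun n => c (n + v) - c n) (along N) (𝓝 0) := by
  set R := max |a| |b| + 1 with hRdef
  have hR : max |a| |b| < R := lt_add_one _
  have hR0 : 0 < R := (le_max_of_le_left (abs_nonneg a)).trans_lt hR
  have hzI : ∀ z : ℂ, R < ‖z‖ → ∀ x ∈ Icc a b, (x : ℂ) ≠ z := by
    intro z hz x hx hxz
    rw [← hxz, Complex.norm_real, Real.norm_eq_abs] at hz
    linarith [abs_le_max_abs_abs hx.1 hx.2]
  have hsI : ∀ n, ∀ x₀ ∈ s n, ∀ x ∈ Icc a b, (x : ℂ) ≠ (x₀ : ℝ) := by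
    intro n x₀ hx₀ x hx hxx
    have := hs n x₀ hx₀
    rw [Complex.ofReal_inj] at hxx
    linarith [hx.1]
  rw [Metric.tendsto_nhds]
  intro δ hδ
  -- The ratio is within `4 ε` of `1`, so the Schwarz bound on the coefficient is `4 R ε ≤ δ / 2`.
  set ε := min (1 / 2) (δ / (8 * R)) with hεdef
  have hε0 : 0 < ε := by positivity
  filter_upwards [h.eventually_normalized hab hYc hs hz hcof hR hε0,
    (tendsto_add_along N v).eventually (h'.eventually_normalized hab hYc hs hz hcof hR hε0)]
    with n hn hn'
  rw [dist_zero_right]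
  have hle := ((hc (n + v)).div (hc n)).norm_le hR0 (ε := 4 * ε)
    (fun z hz => (differentiableAt_normalized hab (hzI z hz) (hsI _)).div
      (differentiableAt_normalized hab (hzI z hz) (hsI _))
      (normalized_ne_zero hab (hzI z hz) (hsI _) (hY _)))
    (fun z hz => by
      obtain ⟨o, ho, heq⟩ := hn z hz
      obtain ⟨o', ho', heq'⟩ := hn' z hz
      rw [heq, heq']
      exact norm_div_sub_one_le (min_le_left _ _) ho ho' (szego_div_ne_zero _ _ _ _))
  refine hle.trans_lt ?_
  have h8 : ε ≤ δ / (8 * R) := min_le_right _ _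
  rw [le_div_iff₀ (by positivity)] at h8
  linarith

end Ratio

/-! ### Recurrence coefficients as limits at infinity -/

section Recurrence

open Polynomial

/-- The terms at `n - e_k` have lower degree than `P n`, so dividing the recurrence by `P n` leaves
`-b` at infinity. As the complex limit is assumed to exist, the positive real axis suffices to
identify it. -/
theorem IsRecurrence.eq_neg_limit {μ₁ μ₂ : Measure ℝ} {P : ℕ × ℕ → ℝ[X]}
    (hP : ∀ n, IsTypeII μ₁ μ₂ n (P n)) {a b : Fin 2 → ℕ × ℕ → ℝ} (h : IsRecurrence P a b)
    (n : ℕ × ℕ) (i : Fin 2) {L : ℂ}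
    (hL : Tendsto (fun z : ℂ => aeval z (P (n + e i)) / aeval z (P n) - z)
      (Bornology.cobounded ℂ) (𝓝 L)) : (b i n : ℂ) = -L := by
  set T : ℝ[X] := (if n.1 = 0 then 0 else C (a 0 n) * P (n.1 - 1, n.2))
      + (if n.2 = 0 then 0 else C (a 1 n) * P (n.1, n.2 - 1)) with hT
  have hrec : X * P n = P (n + e i) + C (b i n) * P n + T := by
    rw [h n i, hT]; ring
  have hdeg : T.degree < (P n).degree := by
    have hn := degree_eq_natDegree (hP n).1.ne_zero
    rw [(hP n).2.1] at hn
    have hbot : (⊥ : WithBot ℕ) < (P n).degree := by rw [hn]; exact WithBot.bot_lt_coe _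
    have hterm : ∀ (c : ℝ) (m : ℕ × ℕ), m.1 + m.2 < n.1 + n.2 →
        (C c * P m).degree < (P n).degree := by
      intro c m hm
      rw [← smul_eq_C_mul]
      refine (degree_smul_le c (P m)).trans_lt ?_
      rw [hn, degree_eq_natDegree (hP m).1.ne_zero, (hP m).2.1]
      exact_mod_cast hm
    refine (degree_add_le _ _).trans_lt (max_lt ?_ ?_)
    · split_ifs with h0
      · rwa [degree_zero]
      · exact hterm _ _ (by dsimp only; omega)
    · split_ifs with h0
      · rwa [degree_zero]
      · exact hterm _ _ (by dsimp only; omega)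
  have hreal : Tendsto (fun x : ℝ => -b i n - T.eval x / (P n).eval x) atTop (𝓝 (-b i n - 0)) :=
    tendsto_const_nhds.sub (div_tendsto_atTop_zero_of_degree_lt T (P n) hdeg)
  rw [sub_zero] at hreal
  have hcomplex := (Complex.continuous_ofReal.tendsto _).comp hreal
  have hcob : Tendsto (fun x : ℝ => (x : ℂ)) atTop (Bornology.cobounded ℂ) := by
    rw [← tendsto_norm_atTop_iff_cobounded]
    simpa using tendsto_abs_atTop_atTop
  have hne : ∀ᶠ x : ℝ in atTop, (P n).eval x ≠ 0 := by
    obtain ⟨x₀, hx₀⟩ := exists_max_root (P n) (hP n).1.ne_zero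
    filter_upwards [eventually_gt_atTop x₀] with x hx h0
    exact absurd (hx₀ x h0) (not_le.mpr hx)
  have heq : (fun x : ℝ => aeval (x : ℂ) (P (n + e i)) / aeval (x : ℂ) (P n) - (x : ℂ)) =ᶠ[atTop]
      (fun x : ℝ => ((-b i n - T.eval x / (P n).eval x : ℝ) : ℂ)) := by
    filter_upwards [hne] with x hx
    have hx' := congrArg (eval x) hrec
    simp only [eval_add, eval_mul, eval_X, eval_C] at hx'
    have ha : ∀ q : ℝ[X], aeval (x : ℂ) q = ((q.eval x : ℝ) : ℂ) := fun q =>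
      aeval_algebraMap_apply_eq_algebraMap_eval x q
    rw [ha, ha, ← Complex.ofReal_div, ← Complex.ofReal_sub]
    congr 1
    field_simp
    linear_combination -hx'
  have huniq := tendsto_nhds_unique ((hL.comp hcob).congr' heq) hcomplex
  rw [huniq]
  push_cast
  ring

end Recurrence

/-! ### Assembling the ratio limits -/

section Limit

open Polynomial

variable {α₁ β₁ α₂ β₂ : ℝ} {μ₁ μ₂ : Measure ℝ}

theorem B₀_eq (α₁ α₂ β₂ : ℝ) (i : Fin 2) :
    B₀ α₁ α₂ β₂ i = ((α₂ + β₂) / 2 : ℝ) + ((e i).1 : ℂ) * phi α₂ β₂ α₁ := by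
  fin_cases i <;> simp [B₀, e]

/-- Each zero on the first interval contributes `x` to the sum of zeros and `A/φ(x)` to the
expansion of `S`. The quadratic equation of `φ` merges the two into `φ(x)` plus a constant. -/
theorem sub_constA_div_phi {a b x : ℝ} (hab : a < b) (hx : x < a) :
    (x : ℂ) - constA a b / phi a b x = phiReal a b x + ((a + b) / 2 : ℝ) := by
  have hI : ∀ y ∈ Icc a b, (y : ℂ) ≠ (x : ℝ) := by
    intro y hy hxy
    rw [Complex.ofReal_inj] at hxy
    linarith [hy.1]
  have hm : (x : ℂ) ≠ ((a + b) / 2 : ℝ) := by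
    intro h
    rw [Complex.ofReal_inj] at h
    linarith
  have hq := phi_quadratic hm
  have h0 := phi_ne_zero hab hI
  rw [← phi_ofReal hab hx]
  field_simp
  linear_combination -hq

/-- The limits of `P_{n + e_i}(z) / P_n(z) - z` as `z → ∞`, and their limit along `N`. -/
theorem IsSystem.exists_limits (h : IsSystem α₁ β₁ α₂ β₂ μ₁ μ₂)
    (hμ₁ : HasAnalyticDensity μ₁ α₁ β₁) {P : ℕ × ℕ → ℝ[X]}
    (hP : ∀ n, IsTypeII μ₁ μ₂ n (P n)) {N : Set (ℕ × ℕ)} (hN : IsMarginal N)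
    (hasymp : VaryingAsymptotics α₁ β₁ α₂ β₂ μ₂ P N) (i : Fin 2)
    (hasymp' : VaryingAsymptotics α₁ β₁ α₂ β₂ μ₂ P ((fun n => n + e i) '' N)) :
    ∃ L : ℕ × ℕ → ℂ,
      (∀ n, Tendsto (fun z : ℂ => aeval z (P (n + e i)) / aeval z (P n) - z)
        (Bornology.cobounded ℂ) (𝓝 (L n))) ∧
      Tendsto L (along N) (𝓝 (-B₀ α₁ α₂ β₂ i)) := by
  choose s Y hs hY hsI hYI hfac hz hcof using fun n => h.exists_roots (hP n)
  have hlt : ∀ n, ∀ x ∈ s n, x < α₂ := fun n x hx => (hsI n x hx).2.trans_lt h.lt₁₂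
  have hei : (e i).1 + (e i).2 = 1 := by fin_cases i <;> rfl
  have hPM : ∀ n, P n = (((s n).val + Y n).map fun y => X - C y).prod := by
    intro n
    rw [Multiset.map_add, Multiset.prod_add]
    exact hfac n
  set σ : ℕ × ℕ → ℂ := fun n => (((s n).val + Y n).map fun y : ℝ => (y : ℂ)).sum with hσ
  refine ⟨fun n => σ n - σ (n + e i), fun n => ?_, ?_⟩
  · rw [hPM n, hPM (n + e i)]
    refine tendsto_aeval_div_sub _ _ ?_
    rw [Multiset.card_add, Multiset.card_add, Finset.card_val, Finset.card_val, hs, hs, hY, hY,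
      Prod.fst_add, Prod.snd_add]
    omega
  have hcoeff := tendsto_coeff_sub h.lt₂ hasymp hasymp' hY hlt hYI hz hcof fun n =>
    hasInvCoeff_normalized (s := s n) (Y := Y n) h.lt₂ fun x₀ hx₀ x hx hxx => by
      rw [Complex.ofReal_inj] at hxx
      linarith [hx.1, hlt n x₀ hx₀]
  -- Subtracting the value at `α₁` makes the summands non-negative and uniformly small; the
  -- subtracted terms are counted exactly by `n₁` and yield `φ₂(α₁)` when `i = 0`.
  set E : ℕ × ℕ → ℝ := fun n =>
    ∑ x ∈ s (n + e i), (phiReal α₂ β₂ x - phiReal α₂ β₂ α₁) -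
      ∑ x ∈ s n, (phiReal α₂ β₂ x - phiReal α₂ β₂ α₁) with hE
  have hα : α₁ < α₂ := h.lt₁.trans h.lt₁₂
  have hroot : ∀ n, ∀ x ∈ s n, x ∈ Icc α₁ β₁ ∧ (P n).IsRoot x := by
    intro n x hx
    refine ⟨hsI n x hx, ?_⟩
    rw [← Finset.mem_val, ← hz, zerosOn, Multiset.mem_filter] at hx
    exact isRoot_of_mem_roots hx.1
  have hEt : Tendsto E (along N) (𝓝 0) := by
    rw [Metric.tendsto_nhds]
    intro η hη
    obtain ⟨δ, hδ, hcont⟩ := Metric.continuousAt_iff.mp (continuousAt_phiReal h.lt₂ hα) (η / 2)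
      (half_pos hη)
    filter_upwards [h.eventually_root_near hμ₁ hP hN 0 hδ,
      h.eventually_root_near hμ₁ hP hN (e i) hδ] with n hn hn'
    rw [add_zero] at hn
    rw [Real.dist_0_eq_abs]
    refine lt_of_le_of_lt (h.abs_sum_phiReal_sub_le (hP n) (hP (n + e i)) ?_ ?_ ?_ (hz n)
      (hz (n + e i)) (half_pos hη).le fun x hx => ?_) (half_lt_self hη)
    · rw [Prod.fst_add]; omega
    · rw [Prod.snd_add]; omega
    · rw [Prod.fst_add, Prod.snd_add]; omega
    · have hxδ : |x - α₁| < δ := by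
        rcases Finset.mem_union.mp hx with hx | hx
        · exact hn x (hroot _ x hx).1 (hroot _ x hx).2
        · exact hn' x (hroot _ x hx).1 (hroot _ x hx).2
      exact (le_abs_self _).trans (hcont hxδ).le
  have hlim := (hcoeff.sub ((Complex.continuous_ofReal.tendsto _).comp hEt)).sub_const
    (B₀ α₁ α₂ β₂ i)
  rw [Complex.ofReal_zero, sub_zero, zero_sub] at hlim
  -- From here on there is an exact identity for each `n`: the difference of sums of zeros equals
  -- the coefficient difference minus `E n` minus `B₀`.
  refine hlim.congr fun n => ?_
  have key : ∀ n, (∑ x ∈ s n, ((phiReal α₂ β₂ x - phiReal α₂ β₂ α₁ : ℝ) : ℂ)) =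
      ∑ x ∈ s n, (x : ℂ) - ∑ x ∈ s n, (constA α₂ β₂ / phi α₂ β₂ x) -
        n.1 * (((α₂ + β₂) / 2 : ℝ) + phi α₂ β₂ α₁) := by
    intro n
    rw [← hs n, ← nsmul_eq_mul, ← Finset.sum_const, ← Finset.sum_sub_distrib,
      ← Finset.sum_sub_distrib]
    refine Finset.sum_congr rfl fun x hx => ?_
    rw [sub_constA_div_phi h.lt₂ (hlt n x hx), phi_ofReal h.lt₂ hα]
    push_cast
    ring
  have hσ' : ∀ n, σ n = ∑ x ∈ s n, (x : ℂ) + ((Y n).map fun y : ℝ => (y : ℂ)).sum := by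
    intro n
    simp only [hσ, Multiset.map_add, Multiset.sum_add]
    rfl
  have hei' : ((e i).1 : ℂ) + (e i).2 = 1 := by exact_mod_cast hei
  simp only [Function.comp, hE]
  rw [Complex.ofReal_sub, Complex.ofReal_sum, Complex.ofReal_sum, key, key, hσ', hσ', B₀_eq, hY,
    hY, Prod.fst_add, Prod.snd_add, Nat.cast_add, Nat.cast_add]
  linear_combination (((α₂ + β₂) / 2 : ℝ) : ℂ) * hei'

end Limit

end Angelesco

end

theorem mainTheorem12
    (α₁ β₁ α₂ β₂ : ℝ) (h₁ : α₁ < β₁) (h₁₂ : β₁ < α₂) (h₂ : α₂ < β₂)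
    (μ₁ μ₂ : Measure ℝ) [IsFiniteMeasure μ₁] [IsFiniteMeasure μ₂]
    (hμ₁ : Angelesco.HasAnalyticDensity μ₁ α₁ β₁)
    (hμ₂ : Angelesco.IsSzegoMeasure μ₂ α₂ β₂)
    (P : ℕ × ℕ → Polynomial ℝ) (hP : ∀ n, Angelesco.IsTypeII μ₁ μ₂ n (P n))
    (N : Set (ℕ × ℕ)) (hN : Angelesco.IsMarginal N)
    (hasymp : Angelesco.VaryingAsymptotics α₁ β₁ α₂ β₂ μ₂ P N) :
    -- all zeros on the first interval tend to its left endpoint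
    (∀ ε > 0, ∀ᶠ n in Angelesco.along N,
      ∀ x ∈ Set.Icc α₁ β₁, (P n).IsRoot x → |x - α₁| < ε) ∧
    -- ratio limits, with the formula also available for the shifted indices
    ∀ i : Fin 2,
      Angelesco.VaryingAsymptotics α₁ β₁ α₂ β₂ μ₂ P ((fun n => n + Angelesco.e i) '' N) →
      (∃ L : ℕ × ℕ → ℂ,
        (∀ n ∈ N, Tendsto
          (fun z : ℂ => Polynomial.aeval z (P (n + Angelesco.e i)) / Polynomial.aeval z (P n) - z)
          (Bornology.cobounded ℂ) (𝓝 (L n))) ∧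
        Tendsto L (Angelesco.along N) (𝓝 (-Angelesco.B₀ α₁ α₂ β₂ i))) ∧
      (∀ a b : Fin 2 → ℕ × ℕ → ℝ, Angelesco.IsRecurrence P a b →
        Tendsto (fun n => (b i n : ℂ)) (Angelesco.along N) (𝓝 (Angelesco.B₀ α₁ α₂ β₂ i))) := by
  have hsys := Angelesco.isSystem_of_analytic_of_szego h₁ h₁₂ h₂ hμ₁ hμ₂
  refine ⟨fun ε hε => ?_, fun i hasymp' => ?_⟩
  · simpa only [add_zero] using hsys.eventually_root_near hμ₁ hP hN 0 hε
  obtain ⟨L, hL, hlim⟩ := hsys.exists_limits hμ₁ hP hN hasymp i hasymp'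
  refine ⟨⟨L, fun n _ => hL n, hlim⟩, fun a b hab => ?_⟩
  have hneg := hlim.neg
  rw [neg_neg] at hneg
  exact hneg.congr fun n => (hab.eq_neg_limit hP n i (hL n)).symm
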